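/- **Theorem 4.2 (One-sided projective Cauchy formula).** Let $\mathbb{H}^2$, with curvature $-1$, be represented by the Beltrami–Klein model, i.e. by the open unit disk of the Euclidean plane with the metric $\cosh d(P,Q)=\dfrac{1-\langle P,Q\rangle}{\sqrt{(1-|P|^2)(1-|Q|^2)}}$, whose geodesics are the Euclidean chords. Let $K$ be a convex body in $\mathbb{H}^2$, that is, a nonempty compact convex subset of the open unit disk. Let $\mathcal P$ be its hyperbolic perimeter: the hyperbolic length of $\partial K$ if $K$ has interior points, and twice the hyperbolic length of $K$ if $K$ is a segment or a point (a degenerate two-gon). For $\varphi\in\mathbb{R}$ let $R=(\cos\varphi,\sin\varphi)$ be the point at infinity with central angle $\varphi$ and let $T=(-\sin\varphi,\cos\varphi)$. The line $\mathbb{R}T$ through the origin perpendicular to the ray from the origin to $R$ is the $\varphi$-normal. The right-hand support line of $K$ from $R$ is the line through $R$ and a point $P\in K$ such that no point of $K$ lies to the right of the ray from $R$ through $P$. Let $\psi_1(\varphi)\in(0,\pi)$ be the smallest of the angles, over $P\in K$, from the direction $T$ (that of the tangent to the unit circle at $R$) to the direction of $P-R$. Then for every $\varphi$ there is exactly one right-hand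 support line of $K$ from $R$, and it meets the $\varphi$-normal in exactly one point $h(\varphi)\,T$; the number $h(\varphi)$ is the signed Euclidean length of the projection of the right-hand support line from $R$ onto the $\varphi$-normal. Moreover $h(\varphi)=\cot\psi_1(\varphi)$ for every $\varphi$, the function $h$ is integrable on $[0,2\pi]$, the perimeter $\mathcal P$ is finite, and $$\mathcal P=\int_0^{2\pi} h(\varphi)\,d\varphi=\int_0^{2\pi}\cot\psi_1(\varphi)\,d\varphi .$$ -/

import Mathlib

open MeasureTheory Set
open scoped ENNReal RealInnerProductSpace

noncomputable section

/-- The Euclidean plane. -/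
abbrev Plane : Type := EuclideanSpace ℝ (Fin 2)

/-! ### The Beltrami-Klein model of the hyperbolic plane of curvature `-1` -/

/-- The underlying set of the Beltrami-Klein model: the open unit disk. -/
@[ext]
structure KleinDisk where
  /-- the Euclidean position of the point -/
  pt : Plane
  norm_lt : ‖pt‖ < 1

namespace KleinDisk

/-- `cosh` of the hyperbolic distance of two points of the Beltrami-Klein model. -/
def coshDist (P Q : KleinDisk) : ℝ :=
  (1 - ⟪P.pt, Q.pt⟫) / (√(1 - ‖P.pt‖ ^ 2) * √(1 - ‖Q.pt‖ ^ 2))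

theorem inner_eq (x y : Plane) : ⟪x, y⟫ = x 0 * y 0 + x 1 * y 1 := by
  simp [PiLp.inner_apply, Fin.sum_univ_two, mul_comm]

theorem normSq_eq (x : Plane) : ‖x‖ ^ 2 = x 0 * x 0 + x 1 * x 1 := by
  rw [← real_inner_self_eq_norm_sq, inner_eq]

theorem weight_pos (P : KleinDisk) : 0 < 1 - ‖P.pt‖ ^ 2 := by
  nlinarith [P.norm_lt, norm_nonneg P.pt]

theorem inner_lt_one (P Q : KleinDisk) : ⟪P.pt, Q.pt⟫ < 1 := by
  nlinarith [real_inner_le_norm P.pt Q.pt, P.norm_lt, Q.norm_lt, norm_nonneg P.pt,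
    norm_nonneg Q.pt]

/-- The square of `coshDist`, cleared of square roots. -/
theorem coshDist_sq (P Q : KleinDisk) :
    coshDist P Q ^ 2 = (1 - ⟪P.pt, Q.pt⟫) ^ 2 / ((1 - ‖P.pt‖ ^ 2) * (1 - ‖Q.pt‖ ^ 2)) := by
  rw [coshDist, div_pow, mul_pow, Real.sq_sqrt P.weight_pos.le, Real.sq_sqrt Q.weight_pos.le]

theorem weight_le (P Q : KleinDisk) :
    (1 - ‖P.pt‖ ^ 2) * (1 - ‖Q.pt‖ ^ 2) + (1 - ‖P.pt‖ ^ 2) * ‖P.pt - Q.pt‖ ^ 2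
      ≤ (1 - ⟪P.pt, Q.pt⟫) ^ 2 := by
  have h : (1 - ⟪P.pt, Q.pt⟫) ^ 2 - ((1 - ‖P.pt‖ ^ 2) * (1 - ‖Q.pt‖ ^ 2)
      + (1 - ‖P.pt‖ ^ 2) * ‖P.pt - Q.pt‖ ^ 2)
      = (P.pt 0 * (P.pt 0 - Q.pt 0) + P.pt 1 * (P.pt 1 - Q.pt 1)) ^ 2 := by
    simp only [normSq_eq, inner_eq, PiLp.sub_apply]; ring
  nlinarith [sq_nonneg (P.pt 0 * (P.pt 0 - Q.pt 0) + P.pt 1 * (P.pt 1 - Q.pt 1))]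

theorem one_le_coshDist (P Q : KleinDisk) : 1 ≤ coshDist P Q := by
  have h0 : 0 ≤ coshDist P Q :=
    div_nonneg (by linarith [inner_lt_one P Q]) (by positivity)
  have h1 : 1 ≤ coshDist P Q ^ 2 := by
    rw [coshDist_sq, one_le_div (mul_pos P.weight_pos Q.weight_pos)]
    nlinarith [weight_le P Q, mul_nonneg P.weight_pos.le (sq_nonneg ‖P.pt - Q.pt‖)]
  nlinarith

theorem coshDist_self (P : KleinDisk) : coshDist P P = 1 := by
  rw [coshDist, real_inner_self_eq_norm_sq, Real.mul_self_sqrt P.weight_pos.le,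
    div_self P.weight_pos.ne']

theorem coshDist_comm (P Q : KleinDisk) : coshDist P Q = coshDist Q P := by
  rw [coshDist, coshDist, real_inner_comm, mul_comm]

theorem eq_of_coshDist_eq_one {P Q : KleinDisk} (h : coshDist P Q = 1) : P = Q := by
  have h1 : coshDist P Q ^ 2 = 1 := by rw [h]; norm_num
  rw [coshDist_sq, div_eq_one_iff_eq (mul_pos P.weight_pos Q.weight_pos).ne'] at h1
  have h2 := weight_le P Q
  have h3 : ‖P.pt - Q.pt‖ ^ 2 = 0 := by
    nlinarith [P.weight_pos, sq_nonneg ‖P.pt - Q.pt‖]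
  have h4 : P.pt = Q.pt := by
    rwa [sq_eq_zero_iff, norm_eq_zero, sub_eq_zero] at h3
  exact KleinDisk.ext h4

/-- The Gram determinant of three points of the hyperboloid is nonnegative. -/
theorem gram_nonneg (P Q R : KleinDisk) :
    coshDist P Q ^ 2 + coshDist Q R ^ 2 + coshDist P R ^ 2
      ≤ 1 + 2 * coshDist P Q * coshDist Q R * coshDist P R := by
  have hp := P.weight_pos
  have hq := Q.weight_pos
  have hr := R.weight_pos
  have hprod : coshDist P Q * coshDist Q R * coshDist P R
      = (1 - ⟪P.pt, Q.pt⟫) * (1 - ⟪Q.pt, R.pt⟫) * (1 - ⟪P.pt, R.pt⟫)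
        / ((1 - ‖P.pt‖ ^ 2) * (1 - ‖Q.pt‖ ^ 2) * (1 - ‖R.pt‖ ^ 2)) := by
    rw [coshDist, coshDist, coshDist, div_mul_div_comm, div_mul_div_comm]
    congr 1
    calc _ = (√(1 - ‖P.pt‖ ^ 2) ^ 2) * (√(1 - ‖Q.pt‖ ^ 2) ^ 2) * (√(1 - ‖R.pt‖ ^ 2) ^ 2) := by
          ring
      _ = _ := by rw [Real.sq_sqrt hp.le, Real.sq_sqrt hq.le, Real.sq_sqrt hr.le]
  have key : 1 + 2 * (coshDist P Q * coshDist Q R * coshDist P R)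
      - (coshDist P Q ^ 2 + coshDist Q R ^ 2 + coshDist P R ^ 2)
      = ((Q.pt 0 - P.pt 0) * (R.pt 1 - P.pt 1) - (Q.pt 1 - P.pt 1) * (R.pt 0 - P.pt 0)) ^ 2
        / ((1 - ‖P.pt‖ ^ 2) * (1 - ‖Q.pt‖ ^ 2) * (1 - ‖R.pt‖ ^ 2)) := by
    rw [hprod, coshDist_sq, coshDist_sq, coshDist_sq]
    have hp' := hp.ne'
    have hq' := hq.ne'
    have hr' := hr.ne'
    field_simp
    simp only [normSq_eq, inner_eq]
    ring
  have hnn : 0 ≤ ((Q.pt 0 - P.pt 0) * (R.pt 1 - P.pt 1)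
      - (Q.pt 1 - P.pt 1) * (R.pt 0 - P.pt 0)) ^ 2
        / ((1 - ‖P.pt‖ ^ 2) * (1 - ‖Q.pt‖ ^ 2) * (1 - ‖R.pt‖ ^ 2)) :=
    div_nonneg (sq_nonneg _) (by positivity)
  linarith

theorem arcosh_triangle (P Q R : KleinDisk) :
    Real.arcosh (coshDist P R) ≤ Real.arcosh (coshDist P Q) + Real.arcosh (coshDist Q R) := by
  have ha := one_le_coshDist P Q
  have hb := one_le_coshDist Q R
  have hc := one_le_coshDist P R
  have hg := gram_nonneg P Q R
  set a := coshDist P Q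
  set b := coshDist Q R
  set c := coshDist P R
  have h1 : c ≤ Real.cosh (Real.arcosh a + Real.arcosh b) := by
    rw [Real.cosh_add, Real.cosh_arcosh ha, Real.cosh_arcosh hb, Real.sinh_arcosh ha,
      Real.sinh_arcosh hb, ← Real.sqrt_mul (by nlinarith)]
    have h2 : c - a * b ≤ √((a ^ 2 - 1) * (b ^ 2 - 1)) :=
      Real.le_sqrt_of_sq_le (by nlinarith)
    linarith
  have h3 : 0 ≤ Real.arcosh a + Real.arcosh b :=
    add_nonneg (Real.arcosh_nonneg ha) (Real.arcosh_nonneg hb)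
  calc Real.arcosh c ≤ Real.arcosh (Real.cosh (Real.arcosh a + Real.arcosh b)) :=
        (Real.arcosh_le_arcosh (by linarith) (Real.cosh_pos _)).2 h1
    _ = _ := Real.arcosh_cosh h3

/-- The hyperbolic metric of curvature `-1` on the Beltrami-Klein disk:
`cosh d(P, Q) = (1 - ⟨P, Q⟩) / √((1 - |P|²) (1 - |Q|²))`. -/
instance : MetricSpace KleinDisk where
  dist P Q := Real.arcosh (coshDist P Q)
  dist_self P := by simp [coshDist_self]
  dist_comm P Q := by simp only [coshDist_comm]
  dist_triangle P Q R := arcosh_triangle P Q R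
  eq_of_dist_eq_zero {P Q} h :=
    eq_of_coshDist_eq_one ((Real.arcosh_eq_zero_iff (one_le_coshDist P Q)).1 h)

theorem dist_def (P Q : KleinDisk) : dist P Q = Real.arcosh (coshDist P Q) := rfl

instance : MeasurableSpace KleinDisk := borel KleinDisk

instance : BorelSpace KleinDisk := ⟨rfl⟩

/-- The metric is Hilbert's cross-ratio metric of the disk: if the chord `AB` of the unit circle
passes through `A`, `P`, `Q`, `B` in this order, the distance of `P` and `Q` is
`½ log ((AQ / AP) (BP / BQ))`. -/
theorem dist_eq_half_log_crossRatio (A B : Plane) (hA : ‖A‖ = 1) (hB : ‖B‖ = 1) (hAB : A ≠ B)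
    (s t : ℝ) (hs : 0 < s) (hst : s ≤ t) (ht : t < 1) (P Q : KleinDisk)
    (hP : P.pt = AffineMap.lineMap A B s) (hQ : Q.pt = AffineMap.lineMap A B t) :
    dist P Q = 1 / 2 * Real.log
      (dist A Q.pt / dist A P.pt * (dist B P.pt / dist B Q.pt)) := by
  have hl : 0 < dist A B := dist_pos.2 hAB
  have e1 : dist A P.pt = s * dist A B := by
    rw [hP, dist_left_lineMap, Real.norm_of_nonneg hs.le]
  have e2 : dist A Q.pt = t * dist A B := by
    rw [hQ, dist_left_lineMap, Real.norm_of_nonneg (by linarith)]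
  have e3 : dist B P.pt = (1 - s) * dist A B := by
    rw [hP, dist_right_lineMap, Real.norm_of_nonneg (by linarith)]
  have e4 : dist B Q.pt = (1 - t) * dist A B := by
    rw [hQ, dist_right_lineMap, Real.norm_of_nonneg (by linarith)]
  have hs1 : 0 < 1 - s := by linarith
  have ht1 : 0 < 1 - t := by linarith
  have ht0 : 0 < t := by linarith
  set u : ℝ := t * (1 - s) / (s * (1 - t)) with hu
  have hu1 : 1 ≤ u := by
    rw [hu, one_le_div (by positivity)]; nlinarith
  have hu0 : 0 < u := by linarith
  have hr : dist A Q.pt / dist A P.pt * (dist B P.pt / dist B Q.pt) = u := by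
    rw [e1, e2, e3, e4, hu]; field_simp
  have cA : A 0 * A 0 + A 1 * A 1 = 1 := by rw [← normSq_eq, hA]; norm_num
  have cB : B 0 * B 0 + B 1 * B 1 = 1 := by rw [← normSq_eq, hB]; norm_num
  have hL : 0 < ‖A - B‖ ^ 2 := by
    rw [dist_eq_norm] at hl; positivity
  have cL : ‖A - B‖ ^ 2 = 2 - 2 * (A 0 * B 0 + A 1 * B 1) := by
    simp only [normSq_eq, PiLp.sub_apply]; linear_combination cA + cB
  have wP : 1 - ‖P.pt‖ ^ 2 = s * (1 - s) * ‖A - B‖ ^ 2 := by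
    rw [cL, hP]
    simp only [normSq_eq, AffineMap.lineMap_apply, vsub_eq_sub, vadd_eq_add, PiLp.add_apply,
      PiLp.smul_apply, PiLp.sub_apply, smul_eq_mul]
    linear_combination (-(1 - s) ^ 2) * cA - s ^ 2 * cB
  have wQ : 1 - ‖Q.pt‖ ^ 2 = t * (1 - t) * ‖A - B‖ ^ 2 := by
    rw [cL, hQ]
    simp only [normSq_eq, AffineMap.lineMap_apply, vsub_eq_sub, vadd_eq_add, PiLp.add_apply,
      PiLp.smul_apply, PiLp.sub_apply, smul_eq_mul]
    linear_combination (-(1 - t) ^ 2) * cA - t ^ 2 * cB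
  have iPQ : 1 - ⟪P.pt, Q.pt⟫ = (s * (1 - t) + t * (1 - s)) / 2 * ‖A - B‖ ^ 2 := by
    rw [cL, hP, hQ]
    simp only [inner_eq, AffineMap.lineMap_apply, vsub_eq_sub, vadd_eq_add, PiLp.add_apply,
      PiLp.smul_apply, PiLp.sub_apply, smul_eq_mul]
    linear_combination (-(1 - s) * (1 - t)) * cA - s * t * cB
  have hlog : 0 ≤ 1 / 2 * Real.log u := by have := Real.log_nonneg hu1; linarith
  rw [hr, dist_def, ← Real.arcosh_cosh hlog]
  congr 1
  have hc0 : 0 ≤ coshDist P Q := by linarith [one_le_coshDist P Q]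
  have hsq : coshDist P Q ^ 2 = Real.cosh (1 / 2 * Real.log u) ^ 2 := by
    have h2 : Real.cosh (1 / 2 * Real.log u) ^ 2 = (Real.cosh (Real.log u) + 1) / 2 := by
      have := Real.cosh_two_mul (1 / 2 * Real.log u)
      have h3 := Real.cosh_sq (1 / 2 * Real.log u)
      rw [show 2 * (1 / 2 * Real.log u) = Real.log u by ring] at this
      linarith
    rw [h2, Real.cosh_log hu0, coshDist_sq, wP, wQ, iPQ, hu]
    have hL' : ‖A - B‖ ≠ 0 := fun h => by simp [h] at hL
    field_simp
    ring
  exact (pow_left_inj₀ hc0 (Real.cosh_pos _).le two_ne_zero).1 hsq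

end KleinDisk

/-- The hyperbolic length of a subset of the unit disk: its one-dimensional Hausdorff measure
with respect to the hyperbolic metric. -/
def hyperbolicLength (s : Set Plane) : ℝ≥0∞ :=
  μH[1] (KleinDisk.pt ⁻¹' s)

open Classical in
/-- The hyperbolic perimeter of a compact convex set `K` in the open unit disk: the hyperbolic
length of its boundary. A convex set without interior points (a point or a segment) counts as a
degenerate two-gon, whose two sides both contribute. -/
def hyperbolicPerimeter (K : Set Plane) : ℝ≥0∞ :=
  if (interior K).Nonempty then hyperbolicLength (frontier K) else 2 * hyperbolicLength K

/-! ### Right-hand support lines from the points at infinity -/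

/-- The point `R` at infinity with central angle `φ`. -/
def idealPoint (φ : ℝ) : Plane := !₂[Real.cos φ, Real.sin φ]

/-- The unit vector perpendicular to the ray from the origin to `idealPoint φ`, on its
counterclockwise side. It spans the `φ`-normal (as a line through the origin), gives the positive
direction on it, and is the positive direction of the tangent of the unit circle at
`idealPoint φ`. -/
def normalDir (φ : ℝ) : Plane := !₂[-Real.sin φ, Real.cos φ]

/-- The two-dimensional cross product; it is nonnegative when `w` points to the left of `v`. -/
def cross (v w : Plane) : ℝ := v 0 * w 1 - v 1 * w 0

/-- `L` is the right-hand support line of `K` as viewed from `R = idealPoint φ`: it joins `R` to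
some point `P` of `K`, and no point of `K` lies to the right of the ray from `R` through `P`. -/
def IsRightSupportLine (K : Set Plane) (φ : ℝ) (L : AffineSubspace ℝ Plane) : Prop :=
  ∃ P ∈ K, L = line[ℝ, idealPoint φ, P] ∧
    ∀ Q ∈ K, 0 ≤ cross (P - idealPoint φ) (Q - idealPoint φ)

/-- The extreme angle `ψ₁(φ)`: the smallest of the angles `∠ S R P`, `P ∈ K`, where
`R = idealPoint φ` and `S` is a point on the positive side of `R` on the tangent of the unit circle
at `R`. -/
def psi₁ (K : Set Plane) (φ : ℝ) : ℝ :=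
  sInf ((fun P => EuclideanGeometry.angle (idealPoint φ + normalDir φ) (idealPoint φ) P) '' K)

end

/-! For `R = idealPoint φ`, put `R` at infinity in the upper half-plane: `raySlope φ` is then the
horizontal coordinate and `exp (-busemann φ)` the height. The right-hand support line is where
`raySlope φ` is maximal on `K`, so `h` is `supportSlope K`. Two facts drive everything: the
`φ`-derivative of `busemann φ P` is `-raySlope φ P` (`hasDerivAt_busemann`), and `busemann φ` is
1-Lipschitz, with equality for a pair of points exactly when they are collinear with `R`
(`KleinDisk.coshDist_eq`).

Upper bound: if `P` and `Q` are touched from the angles `x < y`, then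
`dist_le_integral_supportSlope` bounds their distance by the integral of `h` over `[x, y]` plus a
difference of Busemann values. Hence a real function expands distances on the set of contact points,
and its image has diameter at most the full integral.

Lower bound, for nonempty interior: cut the circle of angles into `n` arcs. The contact points of an
arc form a connected set, whose length is at least a difference of Busemann values; this recovers
the integral over the arc up to `O(1/n²)`. The pieces overlap in null sets, because almost every
support line touches `K` in one point and the angles touching a given point form an arc.

For a segment, the two points at infinity on its line split the circle into two arcs, on each of
which `h` is the slope of one fixed endpoint. Both sides then compare with twice the distance of the
endpoints. -/

noncomputable section

/-! ### Coordinates of a point as seen from a point at infinity -/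

/-- The Euclidean distance of `P` from the tangent of the unit circle at `idealPoint φ`. -/
def depth (φ : ℝ) (P : Plane) : ℝ := 1 - (P 0 * Real.cos φ + P 1 * Real.sin φ)

/-- The signed coordinate of `P` along the `φ`-normal. -/
def lateral (φ : ℝ) (P : Plane) : ℝ := P 1 * Real.cos φ - P 0 * Real.sin φ

/-- The coordinate on the `φ`-normal of its intersection with the line joining `idealPoint φ`
to `P`. -/
def raySlope (φ : ℝ) (P : Plane) : ℝ := lateral φ P / depth φ P

/-- The Busemann function of the hyperbolic plane at `idealPoint φ`, vanishing at the origin. -/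
def busemann (φ : ℝ) (P : Plane) : ℝ := Real.log (depth φ P) - 1 / 2 * Real.log (1 - ‖P‖ ^ 2)

end

theorem abs_radial_le_norm (φ : ℝ) (P : Plane) :
    |P 0 * Real.cos φ + P 1 * Real.sin φ| ≤ ‖P‖ := by
  apply abs_le_of_sq_le_sq _ (norm_nonneg P)
  rw [KleinDisk.normSq_eq]
  nlinarith [sq_nonneg (P 1 * Real.cos φ - P 0 * Real.sin φ), Real.sin_sq_add_cos_sq φ]

theorem abs_lateral_le_norm (φ : ℝ) (P : Plane) : |lateral φ P| ≤ ‖P‖ := by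
  apply abs_le_of_sq_le_sq _ (norm_nonneg P)
  rw [KleinDisk.normSq_eq, lateral]
  nlinarith [sq_nonneg (P 0 * Real.cos φ + P 1 * Real.sin φ), Real.sin_sq_add_cos_sq φ]

theorem one_sub_norm_le_depth (φ : ℝ) (P : Plane) : 1 - ‖P‖ ≤ depth φ P := by
  have := (abs_le.1 (abs_radial_le_norm φ P)).2
  rw [depth]; linarith

theorem depth_pos {P : Plane} (hP : ‖P‖ < 1) (φ : ℝ) : 0 < depth φ P := by
  linarith [one_sub_norm_le_depth φ P]

theorem weight_eq (φ : ℝ) (P : Plane) :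
    1 - ‖P‖ ^ 2 = 2 * depth φ P - depth φ P ^ 2 - lateral φ P ^ 2 := by
  rw [KleinDisk.normSq_eq, depth, lateral]
  linear_combination (-(P 0 ^ 2 + P 1 ^ 2)) * (Real.sin_sq_add_cos_sq φ).symm

theorem one_sub_inner_eq (φ : ℝ) (P Q : Plane) :
    1 - ⟪P, Q⟫ = depth φ P + depth φ Q - depth φ P * depth φ Q - lateral φ P * lateral φ Q := by
  rw [KleinDisk.inner_eq, depth, lateral, depth, lateral]
  linear_combination (-(P 0 * Q 0 + P 1 * Q 1)) * (Real.sin_sq_add_cos_sq φ).symm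

theorem cross_sub_idealPoint (φ : ℝ) (P Q : Plane) :
    cross (P - idealPoint φ) (Q - idealPoint φ)
      = lateral φ P * depth φ Q - depth φ P * lateral φ Q := by
  simp only [cross, idealPoint, PiLp.sub_apply, depth, lateral]
  simp
  linear_combination (P 0 * Q 1 - P 1 * Q 0) * (Real.sin_sq_add_cos_sq φ).symm

/-- Depths are positive in the open disk, so clearing denominators preserves the order. This turns
the support condition into the maximization of a function. -/
theorem raySlope_le_raySlope_iff {P Q : Plane} (hP : ‖P‖ < 1) (hQ : ‖Q‖ < 1) (φ : ℝ) :
    raySlope φ Q ≤ raySlope φ P ↔ 0 ≤ cross (P - idealPoint φ) (Q - idealPoint φ) := by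
  rw [cross_sub_idealPoint, raySlope, raySlope, div_le_div_iff₀ (depth_pos hQ φ) (depth_pos hP φ)]
  constructor <;> intro h <;> linarith

theorem raySlope_eq_raySlope_iff {P Q : Plane} (hP : ‖P‖ < 1) (hQ : ‖Q‖ < 1) (φ : ℝ) :
    raySlope φ Q = raySlope φ P ↔ cross (P - idealPoint φ) (Q - idealPoint φ) = 0 := by
  rw [cross_sub_idealPoint, raySlope, raySlope,
    div_eq_div_iff (depth_pos hQ φ).ne' (depth_pos hP φ).ne']
  constructor <;> intro h <;> linarith

/-! ### Calculus in the angle of the point at infinity -/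

theorem hasDerivAt_depth (P : Plane) (φ : ℝ) :
    HasDerivAt (fun φ => depth φ P) (-lateral φ P) φ := by
  have h := (((Real.hasDerivAt_cos φ).const_mul (P 0)).add
    ((Real.hasDerivAt_sin φ).const_mul (P 1))).const_sub 1
  exact h.congr_deriv (by rw [lateral]; ring)

theorem hasDerivAt_lateral (P : Plane) (φ : ℝ) :
    HasDerivAt (fun φ => lateral φ P) (depth φ P - 1) φ := by
  have h := ((Real.hasDerivAt_cos φ).const_mul (P 1)).sub
    ((Real.hasDerivAt_sin φ).const_mul (P 0))
  exact h.congr_deriv (by rw [depth]; ring)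

/-- In this form the derivative depends on `P` only through the slope and the depth, so points with
equal slope and equal derivative coincide. -/
theorem hasDerivAt_raySlope {P : Plane} (hP : ‖P‖ < 1) (φ : ℝ) :
    HasDerivAt (fun φ => raySlope φ P) (1 + raySlope φ P ^ 2 - (depth φ P)⁻¹) φ := by
  have h0 := (depth_pos hP φ).ne'
  have h := (hasDerivAt_lateral P φ).div (hasDerivAt_depth P φ) h0
  exact h.congr_deriv (by rw [raySlope]; field_simp; ring)

theorem hasDerivAt_busemann {P : Plane} (hP : ‖P‖ < 1) (φ : ℝ) :
    HasDerivAt (fun φ => busemann φ P) (-raySlope φ P) φ := by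
  have h := ((hasDerivAt_depth P φ).log (depth_pos hP φ).ne').sub_const
    (1 / 2 * Real.log (1 - ‖P‖ ^ 2))
  exact h.congr_deriv (by rw [raySlope]; ring)

theorem continuous_raySlope_left {P : Plane} (hP : ‖P‖ < 1) : Continuous fun φ => raySlope φ P :=
  continuous_iff_continuousAt.2 fun φ => (hasDerivAt_raySlope hP φ).continuousAt

theorem integral_raySlope {P : Plane} (hP : ‖P‖ < 1) (x y : ℝ) :
    ∫ φ in x..y, raySlope φ P = busemann x P - busemann y P := by
  have h := intervalIntegral.integral_eq_sub_of_hasDerivAt (a := x) (b := y)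
    (fun φ _ => (hasDerivAt_busemann hP φ)) ((continuous_raySlope_left hP).neg.intervalIntegrable x y)
  rw [intervalIntegral.integral_neg] at h
  linarith

theorem depth_add_two_pi (φ : ℝ) (P : Plane) : depth (φ + 2 * Real.pi) P = depth φ P := by
  simp [depth]

theorem lateral_add_two_pi (φ : ℝ) (P : Plane) : lateral (φ + 2 * Real.pi) P = lateral φ P := by
  simp [lateral]

theorem raySlope_add_two_pi (φ : ℝ) (P : Plane) : raySlope (φ + 2 * Real.pi) P = raySlope φ P := by
  rw [raySlope, raySlope, depth_add_two_pi, lateral_add_two_pi]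

theorem busemann_add_two_pi (φ : ℝ) (P : Plane) :
    busemann (φ + 2 * Real.pi) P = busemann φ P := by
  rw [busemann, busemann, depth_add_two_pi]

theorem abs_raySlope_le {P : Plane} {r : ℝ} (hr : r < 1) (hP : ‖P‖ ≤ r) (φ : ℝ) :
    |raySlope φ P| ≤ (1 - r)⁻¹ := by
  have h1 : 1 - r ≤ depth φ P := by linarith [one_sub_norm_le_depth φ P]
  have h2 := abs_lateral_le_norm φ P
  rw [raySlope, abs_div, abs_of_pos (depth_pos (hP.trans_lt hr) φ), ← one_div]
  exact div_le_div₀ zero_le_one (by linarith) (by linarith) h1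

theorem abs_deriv_raySlope_le {P : Plane} {r : ℝ} (hr : r < 1) (hP : ‖P‖ ≤ r) (φ : ℝ) :
    |1 + raySlope φ P ^ 2 - (depth φ P)⁻¹| ≤ 1 + (1 - r)⁻¹ ^ 2 + (1 - r)⁻¹ := by
  have h1 : 1 - r ≤ depth φ P := by linarith [one_sub_norm_le_depth φ P]
  have h2 := abs_raySlope_le hr hP φ
  have h3 : (depth φ P)⁻¹ ≤ (1 - r)⁻¹ := inv_anti₀ (by linarith) h1
  have h4 : 0 < (depth φ P)⁻¹ := inv_pos.2 (depth_pos (hP.trans_lt hr) φ)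
  have h5 : raySlope φ P ^ 2 ≤ (1 - r)⁻¹ ^ 2 := sq_le_sq' (abs_le.1 h2).1 (abs_le.1 h2).2
  rw [abs_le]
  constructor <;> nlinarith [sq_nonneg (raySlope φ P), sq_nonneg ((1 - r)⁻¹)]

theorem continuousOn_raySlope : ContinuousOn (fun p : ℝ × Plane => raySlope p.1 p.2)
    (univ ×ˢ Metric.ball 0 1) := by
  unfold raySlope
  apply ContinuousOn.div
  · unfold lateral; fun_prop
  · unfold depth; fun_prop
  · intro p hp
    exact (depth_pos (by simpa using hp.2) _).ne'

theorem continuousOn_busemann (φ : ℝ) :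
    ContinuousOn (fun P : Plane => busemann φ P) (Metric.ball 0 1) := by
  unfold busemann
  apply ContinuousOn.sub
  · apply ContinuousOn.log
    · unfold depth; fun_prop
    · intro P hP
      exact (depth_pos (by simpa using hP) _).ne'
  · apply ContinuousOn.mul continuousOn_const
    apply ContinuousOn.log (by fun_prop)
    intro P hP
    have : ‖P‖ < 1 := by simpa using hP
    nlinarith [norm_nonneg P]

/-! ### Busemann functions and the hyperbolic distance -/

/-- This is the half-plane formula `cosh d = cosh (log (y / y')) + (x - x')² / (2 y y')`, with `x`
the slope and `y = exp (-busemann)`. The second term is the defect from equality in the Lipschitz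
bound for `busemann φ`. -/
theorem KleinDisk.coshDist_eq (φ : ℝ) (P Q : KleinDisk) :
    coshDist P Q = Real.cosh (busemann φ P.pt - busemann φ Q.pt)
      + cross (P.pt - idealPoint φ) (Q.pt - idealPoint φ) ^ 2
        / (2 * depth φ P.pt * depth φ Q.pt * (√(1 - ‖P.pt‖ ^ 2) * √(1 - ‖Q.pt‖ ^ 2))) := by
  have hp := depth_pos P.norm_lt φ
  have hq := depth_pos Q.norm_lt φ
  have wp := Real.sqrt_pos.2 P.weight_pos
  have wq := Real.sqrt_pos.2 Q.weight_pos
  have sp := Real.sq_sqrt P.weight_pos.le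
  have sq := Real.sq_sqrt Q.weight_pos.le
  have hB : busemann φ P.pt - busemann φ Q.pt
      = Real.log ((depth φ P.pt * √(1 - ‖Q.pt‖ ^ 2)) / (depth φ Q.pt * √(1 - ‖P.pt‖ ^ 2))) := by
    rw [Real.log_div (by positivity) (by positivity), Real.log_mul hp.ne' wq.ne',
      Real.log_mul hq.ne' wp.ne', Real.log_sqrt P.weight_pos.le, Real.log_sqrt Q.weight_pos.le,
      busemann, busemann]
    ring
  rw [hB, Real.cosh_log (by positivity), coshDist, cross_sub_idealPoint, one_sub_inner_eq φ]
  rw [weight_eq φ] at sp sq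
  simp only [weight_eq φ] at wp wq ⊢
  set u := √(2 * depth φ P.pt - depth φ P.pt ^ 2 - lateral φ P.pt ^ 2)
  set v := √(2 * depth φ Q.pt - depth φ Q.pt ^ 2 - lateral φ Q.pt ^ 2)
  set a := depth φ P.pt
  set b := depth φ Q.pt
  field_simp
  linear_combination (-b ^ 2) * sp - a ^ 2 * sq

theorem KleinDisk.abs_busemann_sub_le_dist (φ : ℝ) (P Q : KleinDisk) :
    |busemann φ P.pt - busemann φ Q.pt| ≤ dist P Q := by
  have hp := depth_pos P.norm_lt φ
  have hq := depth_pos Q.norm_lt φ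
  rw [dist_def, ← Real.arcosh_cosh (abs_nonneg (busemann φ P.pt - busemann φ Q.pt)),
    Real.arcosh_le_arcosh (Real.cosh_pos _) (by linarith [one_le_coshDist P Q]), Real.cosh_abs,
    coshDist_eq φ P Q]
  have : 0 ≤ cross (P.pt - idealPoint φ) (Q.pt - idealPoint φ) ^ 2
        / (2 * depth φ P.pt * depth φ Q.pt * (√(1 - ‖P.pt‖ ^ 2) * √(1 - ‖Q.pt‖ ^ 2))) := by
    positivity
  linarith

theorem KleinDisk.abs_busemann_sub_eq_dist_iff (φ : ℝ) (P Q : KleinDisk) :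
    |busemann φ P.pt - busemann φ Q.pt| = dist P Q ↔ raySlope φ P.pt = raySlope φ Q.pt := by
  have hp := depth_pos P.norm_lt φ
  have hq := depth_pos Q.norm_lt φ
  have wp := Real.sqrt_pos.2 P.weight_pos
  have wq := Real.sqrt_pos.2 Q.weight_pos
  rw [eq_comm (a := raySlope φ P.pt), raySlope_eq_raySlope_iff P.norm_lt Q.norm_lt]
  constructor
  · intro h
    have h1 : coshDist P Q = Real.cosh (busemann φ P.pt - busemann φ Q.pt) := by
      rw [← Real.cosh_abs, h, dist_def, Real.cosh_arcosh (one_le_coshDist P Q)]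
    have h2 := coshDist_eq φ P Q
    rw [h1, left_eq_add, div_eq_zero_iff] at h2
    rcases h2 with h2 | h2
    · exact pow_eq_zero_iff two_ne_zero |>.1 h2
    · exact absurd h2 (by positivity)
  · intro h
    rw [dist_def, coshDist_eq φ P Q, h, zero_pow two_ne_zero, zero_div, add_zero, ← Real.cosh_abs,
      Real.arcosh_cosh (abs_nonneg _)]

/-! ### Contact sets and the support function at infinity -/

noncomputable section

/-- The points of `K` on the right-hand support line of `K` from `idealPoint φ`. -/
def contactSet (K : Set Plane) (φ : ℝ) : Set Plane :=
  {P | P ∈ K ∧ ∀ Q ∈ K, raySlope φ Q ≤ raySlope φ P}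

/-- The coordinate on the `φ`-normal of its intersection with the right-hand support line of `K`
from `idealPoint φ`. -/
def supportSlope (K : Set Plane) (φ : ℝ) : ℝ := sSup (raySlope φ '' K)

end

theorem contactSet_subset (K : Set Plane) (φ : ℝ) : contactSet K φ ⊆ K := fun _ h => h.1

theorem supportSlope_eq_of_mem {K : Set Plane} {φ : ℝ} {P : Plane} (hP : P ∈ contactSet K φ) :
    supportSlope K φ = raySlope φ P :=
  IsGreatest.csSup_eq ⟨mem_image_of_mem _ hP.1, forall_mem_image.2 hP.2⟩

theorem norm_lt_one_of_mem {K : Set Plane} (hb : K ⊆ Metric.ball 0 1) {P : Plane} (hP : P ∈ K) :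
    ‖P‖ < 1 := by simpa using hb hP

theorem contactSet_nonempty {K : Set Plane} (hc : IsCompact K) (hn : K.Nonempty)
    (hb : K ⊆ Metric.ball 0 1) (φ : ℝ) : (contactSet K φ).Nonempty := by
  have h : ContinuousOn (fun P : Plane => raySlope φ P) K :=
    continuousOn_raySlope.comp (f := fun P : Plane => (φ, P)) (by fun_prop)
      fun P hP => ⟨mem_univ _, hb hP⟩
  obtain ⟨P, hP, hmax⟩ := hc.exists_isMaxOn hn h
  exact ⟨P, hP, fun Q hQ => hmax hQ⟩

theorem raySlope_le_supportSlope {K : Set Plane} (hc : IsCompact K) (hb : K ⊆ Metric.ball 0 1)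
    {P : Plane} (hP : P ∈ K) (φ : ℝ) : raySlope φ P ≤ supportSlope K φ := by
  obtain ⟨Q, hQ⟩ := contactSet_nonempty hc ⟨P, hP⟩ hb φ
  rw [supportSlope_eq_of_mem hQ]
  exact hQ.2 P hP

theorem mem_contactSet_iff {K : Set Plane} (hc : IsCompact K) (hb : K ⊆ Metric.ball 0 1)
    {P : Plane} {φ : ℝ} : P ∈ contactSet K φ ↔ P ∈ K ∧ raySlope φ P = supportSlope K φ := by
  refine ⟨fun h => ⟨h.1, (supportSlope_eq_of_mem h).symm⟩, fun h => ⟨h.1, fun Q hQ => ?_⟩⟩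
  rw [h.2]
  exact raySlope_le_supportSlope hc hb hQ φ

theorem contactSet_add_two_pi (K : Set Plane) (φ : ℝ) :
    contactSet K (φ + 2 * Real.pi) = contactSet K φ := by
  simp only [contactSet, raySlope_add_two_pi]

theorem supportSlope_add_two_pi (K : Set Plane) (φ : ℝ) :
    supportSlope K (φ + 2 * Real.pi) = supportSlope K φ := by
  have : raySlope (φ + 2 * Real.pi) = raySlope φ := funext fun P => raySlope_add_two_pi φ P
  rw [supportSlope, supportSlope, this]

theorem exists_norm_le {K : Set Plane} (hc : IsCompact K) (hn : K.Nonempty)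
    (hb : K ⊆ Metric.ball 0 1) : ∃ r < 1, ∀ P ∈ K, ‖P‖ ≤ r := by
  obtain ⟨P, hP, hmax⟩ := hc.exists_isMaxOn hn (continuous_norm.continuousOn)
  exact ⟨‖P‖, norm_lt_one_of_mem hb hP, fun Q hQ => hmax hQ⟩

/-- Compactness keeps `K` in a disk of radius `r < 1`, where the slopes have a uniform derivative
bound; a supremum of `C`-Lipschitz functions is `C`-Lipschitz. -/
theorem exists_lipschitzWith_raySlope {K : Set Plane} (hc : IsCompact K) (hn : K.Nonempty)
    (hb : K ⊆ Metric.ball 0 1) :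
    ∃ C : NNReal, (∀ P ∈ K, LipschitzWith C fun φ => raySlope φ P) ∧
      LipschitzWith C (supportSlope K) := by
  obtain ⟨r, hr, hK⟩ := exists_norm_le hc hn hb
  have hr' : 0 ≤ (1 - r)⁻¹ := inv_nonneg.2 (by linarith)
  set C : NNReal := ⟨1 + (1 - r)⁻¹ ^ 2 + (1 - r)⁻¹, by positivity⟩ with hC
  have hP : ∀ P ∈ K, LipschitzWith C fun φ => raySlope φ P := fun P hP => by
    have hP1 := norm_lt_one_of_mem hb hP
    refine lipschitzWith_of_nnnorm_deriv_le
      (fun φ => (hasDerivAt_raySlope hP1 φ).differentiableAt) fun φ => ?_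
    rw [(hasDerivAt_raySlope hP1 φ).deriv, ← NNReal.coe_le_coe, coe_nnnorm, Real.norm_eq_abs]
    exact abs_deriv_raySlope_le hr (hK P hP) φ
  refine ⟨C, hP, LipschitzWith.of_le_add_mul _ fun x y => ?_⟩
  obtain ⟨P, hPx⟩ := contactSet_nonempty hc hn hb x
  have h1 := (hP P hPx.1).le_add_mul x y
  have h2 := raySlope_le_supportSlope hc hb hPx.1 y
  rw [supportSlope_eq_of_mem hPx]
  linarith

theorem continuous_supportSlope {K : Set Plane} (hc : IsCompact K) (hn : K.Nonempty)
    (hb : K ⊆ Metric.ball 0 1) : Continuous (supportSlope K) := by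
  obtain ⟨C, -, h⟩ := exists_lipschitzWith_raySlope hc hn hb
  exact h.continuous

theorem depth_lateral_injective {φ : ℝ} {P Q : Plane} (h1 : depth φ P = depth φ Q)
    (h2 : lateral φ P = lateral φ Q) : P = Q := by
  simp only [depth, lateral] at h1 h2
  have hs := Real.sin_sq_add_cos_sq φ
  ext i
  fin_cases i
  · simp only [Fin.zero_eta]
    linear_combination (-Real.cos φ) * h1 - Real.sin φ * h2 - (P 0 - Q 0) * hs
  · simp only [Fin.mk_one]
    linear_combination (-Real.sin φ) * h1 + Real.cos φ * h2 - (P 1 - Q 1) * hs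

/-- At almost every point at infinity the support line touches `K` in a single point. -/
theorem ae_subsingleton_contactSet {K : Set Plane} (hc : IsCompact K) (hn : K.Nonempty)
    (hb : K ⊆ Metric.ball 0 1) : ∀ᵐ φ : ℝ, (contactSet K φ).Subsingleton := by
  obtain ⟨C, -, h⟩ := exists_lipschitzWith_raySlope hc hn hb
  filter_upwards [h.ae_differentiableAt_real] with φ hφ
  have key : ∀ P ∈ contactSet K φ,
      deriv (supportSlope K) φ = 1 + supportSlope K φ ^ 2 - (depth φ P)⁻¹ := fun P hP => by
    have hP1 := norm_lt_one_of_mem hb hP.1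
    have hd := hφ.hasDerivAt.sub (hasDerivAt_raySlope hP1 φ)
    -- The difference is nonnegative and vanishes at `φ`, so the two derivatives agree there. The
    -- derivative of the support slope thus determines the depth of every contact point.
    have hmin : IsLocalMin (supportSlope K - fun φ => raySlope φ P) φ :=
      Filter.Eventually.of_forall fun θ => by
        have := raySlope_le_supportSlope hc hb hP.1 θ
        simp only [Pi.sub_apply, supportSlope_eq_of_mem hP]
        linarith
    have := hmin.hasDerivAt_eq_zero hd
    rw [supportSlope_eq_of_mem hP]
    linarith
  intro P hP Q hQ
  have hP1 := depth_pos (norm_lt_one_of_mem hb hP.1) φ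
  have hQ1 := depth_pos (norm_lt_one_of_mem hb hQ.1) φ
  have h1 : depth φ P = depth φ Q := inv_injective (by linarith [key P hP, key Q hQ])
  refine depth_lateral_injective h1 ?_
  have h2 : raySlope φ P = raySlope φ Q := by
    rw [← supportSlope_eq_of_mem hP, supportSlope_eq_of_mem hQ]
  rw [raySlope, raySlope, h1, div_left_inj' hQ1.ne'] at h2
  exact h2

/-- With the slope fixed at its maximum, the contact condition `lateral = slope * depth` is affine
in the point. -/
theorem convex_contactSet {K : Set Plane} (hc : IsCompact K) (hv : Convex ℝ K)
    (hb : K ⊆ Metric.ball 0 1) (φ : ℝ) : Convex ℝ (contactSet K φ) := by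
  intro P hP Q hQ s t hs ht hst
  rw [mem_contactSet_iff hc hb] at hP hQ ⊢
  have hR := hv hP.1 hQ.1 hs ht hst
  refine ⟨hR, ?_⟩
  have h1 := hP.2
  have h2 := hQ.2
  rw [raySlope, div_eq_iff (depth_pos (norm_lt_one_of_mem hb hP.1) φ).ne'] at h1
  rw [raySlope, div_eq_iff (depth_pos (norm_lt_one_of_mem hb hQ.1) φ).ne'] at h2
  rw [raySlope, div_eq_iff (depth_pos (norm_lt_one_of_mem hb hR) φ).ne']
  simp only [lateral, depth, PiLp.add_apply, PiLp.smul_apply, smul_eq_mul] at *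
  linear_combination s * h1 + t * h2 + supportSlope K φ * hst

theorem isClosed_contactGraph {K : Set Plane} (hc : IsCompact K) (hb : K ⊆ Metric.ball 0 1) :
    IsClosed {p : ℝ × Plane | p.2 ∈ contactSet K p.1} := by
  rcases K.eq_empty_or_nonempty with rfl | hn
  · simp [contactSet]
  have h1 : IsClosed (univ ×ˢ K : Set (ℝ × Plane)) := isClosed_univ.prod hc.isClosed
  have h2 : ContinuousOn (fun p : ℝ × Plane => raySlope p.1 p.2 - supportSlope K p.1)
      (univ ×ˢ K) := by
    apply (continuousOn_raySlope.mono (prod_mono_right hb)).sub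
    exact ((continuous_supportSlope hc hn hb).comp continuous_fst).continuousOn
  have h3 := h2.preimage_isClosed_of_isClosed h1 isClosed_singleton (t := {0})
  convert h3 using 1
  ext p
  simp only [mem_ofPred_eq, mem_inter_iff, mem_prod, mem_univ, true_and, mem_preimage,
    mem_singleton_iff, sub_eq_zero]
  exact mem_contactSet_iff hc hb

/-! ### Support lines and extreme angles -/

theorem isRightSupportLine_iff {K : Set Plane} (hb : K ⊆ Metric.ball 0 1) {φ : ℝ}
    {L : AffineSubspace ℝ Plane} :
    IsRightSupportLine K φ L ↔ ∃ P ∈ contactSet K φ, L = line[ℝ, idealPoint φ, P] := by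
  constructor
  · rintro ⟨P, hP, rfl, h⟩
    exact ⟨P, ⟨hP, fun Q hQ => (raySlope_le_raySlope_iff (norm_lt_one_of_mem hb hP)
      (norm_lt_one_of_mem hb hQ) φ).2 (h Q hQ)⟩, rfl⟩
  · rintro ⟨P, hP, rfl⟩
    exact ⟨P, hP.1, rfl, fun Q hQ => (raySlope_le_raySlope_iff (norm_lt_one_of_mem hb hP.1)
      (norm_lt_one_of_mem hb hQ) φ).1 (hP.2 Q hQ)⟩

/-- Depth is affine, equal to 0 at the ideal point and to 1 on the `φ`-normal; this forces the
parameter `(depth φ P)⁻¹`. -/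
theorem smul_normalDir_eq {P : Plane} (hP : ‖P‖ < 1) (φ : ℝ) :
    raySlope φ P • normalDir φ = AffineMap.lineMap (idealPoint φ) P (depth φ P)⁻¹ := by
  have h0 := (depth_pos hP φ).ne'
  have hs := Real.sin_sq_add_cos_sq φ
  ext i
  fin_cases i
  · simp only [raySlope, normalDir, idealPoint, AffineMap.lineMap_apply, Fin.zero_eta,
      PiLp.smul_apply, smul_eq_mul, vsub_eq_sub, vadd_eq_add, PiLp.add_apply, PiLp.sub_apply]
    simp
    field_simp
    simp only [lateral, depth]
    linear_combination P 0 * hs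
  · simp only [raySlope, normalDir, idealPoint, AffineMap.lineMap_apply, Fin.mk_one,
      PiLp.smul_apply, smul_eq_mul, vsub_eq_sub, vadd_eq_add, PiLp.add_apply, PiLp.sub_apply]
    simp
    field_simp
    simp only [lateral, depth]
    linear_combination P 1 * hs

theorem line_eq_line_normalDir {P : Plane} (hP : ‖P‖ < 1) (φ : ℝ) :
    line[ℝ, idealPoint φ, P] = line[ℝ, idealPoint φ, raySlope φ P • normalDir φ] := by
  have h0 := (depth_pos hP φ).ne'
  apply le_antisymm
  · refine affineSpan_pair_le_of_mem_of_mem (left_mem_affineSpan_pair _ _ _) ?_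
    have : P = AffineMap.lineMap (idealPoint φ) (raySlope φ P • normalDir φ) (depth φ P) := by
      rw [smul_normalDir_eq hP, AffineMap.lineMap_lineMap_right, mul_inv_cancel₀ h0]
      simp
    have h := AffineMap.lineMap_mem_affineSpan_pair (depth φ P) (idealPoint φ)
      (raySlope φ P • normalDir φ)
    rwa [← this] at h
  · refine affineSpan_pair_le_of_mem_of_mem (left_mem_affineSpan_pair _ _ _) ?_
    rw [smul_normalDir_eq hP]
    exact AffineMap.lineMap_mem_affineSpan_pair _ _ _

theorem smul_normalDir_mem_line_iff (φ x y : ℝ) :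
    x • normalDir φ ∈ line[ℝ, idealPoint φ, y • normalDir φ] ↔ x = y := by
  constructor
  · intro h
    obtain ⟨t, ht⟩ := mem_affineSpan_pair_iff_exists_lineMap_eq.1 h
    have hs := Real.sin_sq_add_cos_sq φ
    have e0 := congrArg (fun v : Plane => v 0) ht
    have e1 := congrArg (fun v : Plane => v 1) ht
    simp [AffineMap.lineMap_apply, idealPoint, normalDir] at e0 e1
    have h1 : t = 1 := by
      linear_combination (-Real.cos φ) * e0 - Real.sin φ * e1 + (1 - t) * hs
    subst h1
    linear_combination (Real.sin φ) * e0 - Real.cos φ * e1 + (y - x) * hs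
  · rintro rfl
    exact right_mem_affineSpan_pair _ _ _

theorem existsUnique_isRightSupportLine {K : Set Plane} (hc : IsCompact K) (hn : K.Nonempty)
    (hb : K ⊆ Metric.ball 0 1) (φ : ℝ) :
    ∃! L : AffineSubspace ℝ Plane, IsRightSupportLine K φ L := by
  have key : ∀ P ∈ contactSet K φ, line[ℝ, idealPoint φ, P]
      = line[ℝ, idealPoint φ, supportSlope K φ • normalDir φ] := fun P hP => by
    rw [line_eq_line_normalDir (norm_lt_one_of_mem hb hP.1), supportSlope_eq_of_mem hP]
  obtain ⟨P, hP⟩ := contactSet_nonempty hc hn hb φ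
  refine ⟨_, (isRightSupportLine_iff hb).2 ⟨P, hP, rfl⟩, fun L hL => ?_⟩
  obtain ⟨Q, hQ, rfl⟩ := (isRightSupportLine_iff hb).1 hL
  rw [key P hP, key Q hQ]

theorem smul_normalDir_mem_supportLine_iff {K : Set Plane} (hb : K ⊆ Metric.ball 0 1) {φ : ℝ}
    {L : AffineSubspace ℝ Plane} (hL : IsRightSupportLine K φ L) (x : ℝ) :
    x • normalDir φ ∈ L ↔ x = supportSlope K φ := by
  obtain ⟨P, hP, rfl⟩ := (isRightSupportLine_iff hb).1 hL
  rw [line_eq_line_normalDir (norm_lt_one_of_mem hb hP.1), ← supportSlope_eq_of_mem hP,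
    smul_normalDir_mem_line_iff]

/-- The vector from the ideal point to `P` has tangential part `lateral` and inward part `depth`, so
the slope is the cotangent of the angle. -/
theorem angle_tangent_eq {P : Plane} (hP : ‖P‖ < 1) (φ : ℝ) :
    EuclideanGeometry.angle (idealPoint φ + normalDir φ) (idealPoint φ) P
      = Real.pi / 2 - Real.arctan (raySlope φ P) := by
  have h0 := depth_pos hP φ
  have hs := Real.sin_sq_add_cos_sq φ
  have e1 : ⟪normalDir φ, P - idealPoint φ⟫ = lateral φ P := by
    rw [KleinDisk.inner_eq]
    simp [normalDir, idealPoint, lateral]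
    ring
  have e2 : ‖normalDir φ‖ = 1 := by
    rw [← sq_eq_sq₀ (norm_nonneg _) zero_le_one, KleinDisk.normSq_eq]
    simp [normalDir]
    linear_combination hs
  have e3 : ‖P - idealPoint φ‖ = depth φ P * √(1 + raySlope φ P ^ 2) := by
    rw [← sq_eq_sq₀ (norm_nonneg _) (by positivity), KleinDisk.normSq_eq, mul_pow,
      Real.sq_sqrt (by positivity), raySlope]
    field_simp
    simp [idealPoint, lateral, depth]
    linear_combination (1 - P 0 ^ 2 - P 1 ^ 2) * hs
  rw [EuclideanGeometry.angle, InnerProductGeometry.angle, vsub_eq_sub, vsub_eq_sub,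
    add_sub_cancel_left, e1, e2, e3, one_mul, ← div_div, ← raySlope, ← Real.sin_arctan,
    ← Real.cos_pi_div_two_sub, Real.arccos_cos]
  · linarith [Real.arctan_lt_pi_div_two (raySlope φ P)]
  · linarith [Real.neg_pi_div_two_lt_arctan (raySlope φ P), Real.pi_pos]

theorem psi₁_eq {K : Set Plane} (hc : IsCompact K) (hn : K.Nonempty)
    (hb : K ⊆ Metric.ball 0 1) (φ : ℝ) :
    psi₁ K φ = Real.pi / 2 - Real.arctan (supportSlope K φ) := by
  obtain ⟨P, hP⟩ := contactSet_nonempty hc hn hb φ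
  rw [supportSlope_eq_of_mem hP, psi₁]
  refine IsLeast.csInf_eq ⟨⟨P, hP.1, angle_tangent_eq (norm_lt_one_of_mem hb hP.1) φ⟩, ?_⟩
  rintro _ ⟨Q, hQ, rfl⟩
  simp only [angle_tangent_eq (norm_lt_one_of_mem hb hQ)]
  linarith [Real.arctan_strictMono.monotone (hP.2 Q hQ)]

theorem cot_psi₁_eq {K : Set Plane} (hc : IsCompact K) (hn : K.Nonempty)
    (hb : K ⊆ Metric.ball 0 1) (φ : ℝ) : Real.cot (psi₁ K φ) = supportSlope K φ := by
  rw [psi₁_eq hc hn hb, Real.cot_eq_cos_div_sin, Real.cos_pi_div_two_sub,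
    Real.sin_pi_div_two_sub, ← Real.tan_eq_sin_div_cos, Real.tan_arctan]

/-! ### The boundary arc between two contact points is at least as long as their distance -/

theorem eq_of_raySlope_eq_on {P Q : Plane} (hP : ‖P‖ < 1) (hQ : ‖Q‖ < 1) {x y : ℝ} (hxy : x < y)
    (h : ∀ θ ∈ Icc x y, raySlope θ P = raySlope θ Q) : P = Q := by
  set m := (x + y) / 2 with hm
  have hmem : m ∈ Ioo x y := ⟨by linarith, by linarith⟩
  have hev : (fun θ => raySlope θ P) =ᶠ[nhds m] fun θ => raySlope θ Q :=
    Filter.eventually_of_mem (Ioo_mem_nhds hmem.1 hmem.2) fun θ hθ => h θ (Ioo_subset_Icc_self hθ)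
  have h1 := ((hasDerivAt_raySlope hQ m).congr_of_eventuallyEq hev).unique
    (hasDerivAt_raySlope hP m)
  have h2 := h m (Ioo_subset_Icc_self hmem)
  rw [h2] at h1
  have h3 : depth m P = depth m Q := inv_injective (by linarith)
  refine depth_lateral_injective h3 ?_
  rw [raySlope, raySlope, h3, div_left_inj' (depth_pos hQ m).ne'] at h2
  exact h2

/-- A maximum at an endpoint gives only one sign of the derivative; `hx` and `hy` supply the other.
-/
theorem eq_zero_of_isMaxOn_Icc {f : ℝ → ℝ} {f' x y θ : ℝ} (hθ : θ ∈ Icc x y)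
    (hmax : IsMaxOn f (Icc x y) θ) (hf : HasDerivAt f f' θ)
    (hx : θ = x → 0 ≤ f') (hy : θ = y → f' ≤ 0) : f' = 0 := by
  have key : ∀ z ∈ Icc x y, (z - θ) * f' ≤ 0 := fun z hz => by
    have h1 : z - θ ∈ posTangentConeAt (Icc x y) θ := by
      apply mem_posTangentConeAt_of_segment_subset
      rw [add_sub_cancel]
      exact (convex_Icc x y).segment_subset hθ hz
    simpa using hmax.localize.hasFDerivWithinAt_nonpos hf.hasFDerivAt.hasFDerivWithinAt h1
  apply le_antisymm
  · rcases hθ.2.eq_or_lt with h | h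
    · exact hy h
    · nlinarith [key y ⟨hθ.1.trans hθ.2, le_rfl⟩]
  · rcases hθ.1.eq_or_lt with h | h
    · exact hx h.symm
    · nlinarith [key x ⟨le_rfl, hθ.1.trans hθ.2⟩]

theorem busemann_sub_le_integral {K : Set Plane} (hc : IsCompact K) (hb : K ⊆ Metric.ball 0 1)
    {P : Plane} (hP : P ∈ K) {x y : ℝ} (hxy : x ≤ y) :
    busemann x P - busemann y P ≤ ∫ θ in x..y, supportSlope K θ := by
  have hP1 := norm_lt_one_of_mem hb hP
  rw [← integral_raySlope hP1]
  exact intervalIntegral.integral_mono_on hxy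
    ((continuous_raySlope_left hP1).intervalIntegrable _ _)
    ((continuous_supportSlope hc ⟨P, hP⟩ hb).intervalIntegrable _ _)
    fun θ _ => raySlope_le_supportSlope hc hb hP θ

/-- Following the slope of `P` up to `θ` and that of `Q` afterwards bounds the right side below by
`D θ`, for every `θ` in `[x, y]`. At a maximum of `D` the derivative vanishes, even at an endpoint,
by the contact hypotheses. There `P` and `Q` are collinear with the ideal point, so `|D θ|` is their
distance. -/
theorem dist_le_integral_supportSlope {K : Set Plane} (hc : IsCompact K)
    (hb : K ⊆ Metric.ball 0 1) {P Q : KleinDisk} {x y : ℝ} (hxy : x < y)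
    (hP : P.pt ∈ contactSet K x) (hQ : Q.pt ∈ contactSet K y) :
    dist P Q ≤ (∫ θ in x..y, supportSlope K θ) + busemann y Q.pt - busemann x P.pt := by
  have hcont := continuous_supportSlope hc ⟨_, hP.1⟩ hb
  set D : ℝ → ℝ := fun θ => busemann θ Q.pt - busemann θ P.pt with hD
  have hD' : ∀ θ, HasDerivAt D (raySlope θ P.pt - raySlope θ Q.pt) θ := fun θ =>
    ((hasDerivAt_busemann Q.norm_lt θ).sub (hasDerivAt_busemann P.norm_lt θ)).congr_deriv (by ring)
  have hbound : ∀ θ ∈ Icc x y,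
      D θ ≤ (∫ θ in x..y, supportSlope K θ) + busemann y Q.pt - busemann x P.pt := by
    intro θ hθ
    rw [← intervalIntegral.integral_add_adjacent_intervals (hcont.intervalIntegrable x θ)
      (hcont.intervalIntegrable θ y)]
    have h1 := busemann_sub_le_integral hc hb hP.1 hθ.1
    have h2 := busemann_sub_le_integral hc hb hQ.1 hθ.2
    simp only [hD]
    linarith
  have hDle : ∀ θ, |D θ| ≤ dist P Q := fun θ => by
    rw [dist_comm]; exact KleinDisk.abs_busemann_sub_le_dist θ Q P
  obtain ⟨θ, hθ, hmax⟩ := isCompact_Icc.exists_isMaxOn (nonempty_Icc.2 hxy.le)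
    (continuous_iff_continuousAt.2 fun θ => (hD' θ).continuousAt).continuousOn
  have hcrit : raySlope θ P.pt - raySlope θ Q.pt = 0 :=
    eq_zero_of_isMaxOn_Icc hθ hmax (hD' θ)
      (fun h => by subst h; linarith [hP.2 _ hQ.1]) (fun h => by subst h; linarith [hQ.2 _ hP.1])
  have habs : |D θ| = dist P Q := by
    rw [dist_comm, ← (KleinDisk.abs_busemann_sub_eq_dist_iff θ Q P).2 (by linarith)]
  rcases abs_eq (dist_nonneg) |>.1 habs with h | h
  · rw [← h]; exact hbound θ hθ
  -- If the maximum of `D` is `-dist P Q`, then `D` equals this minimal possible value on all of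
  -- `[x, y]`. The points are then collinear with every ideal point of the arc, which forces them to
  -- coincide.
  · have hPQ : P = Q := by
      apply KleinDisk.ext
      refine eq_of_raySlope_eq_on P.norm_lt Q.norm_lt hxy fun η hη => ?_
      rw [eq_comm, ← KleinDisk.abs_busemann_sub_eq_dist_iff, dist_comm]
      refine le_antisymm (hDle η) ?_
      have : D η ≤ D θ := hmax hη
      have := neg_abs_le (D η)
      change dist P Q ≤ |D η|
      linarith
    subst hPQ
    rw [dist_self] at h ⊢
    have := hbound θ hθ
    linarith

/-! ### Upper bound of the boundary length -/

/-- On `E` the function has a 1-Lipschitz inverse, which cannot increase one-dimensional measure. -/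
theorem hausdorffMeasure_le_volume_image {X : Type*} [MetricSpace X] [MeasurableSpace X]
    [BorelSpace X] (E : Set X) (f : X → ℝ)
    (h : ∀ x ∈ E, ∀ y ∈ E, dist x y ≤ |f x - f y|) : μH[1] E ≤ volume (f '' E) := by
  have h1 : AntilipschitzWith 1 fun x : E => f x := AntilipschitzWith.of_le_mul_dist fun x y => by
    rw [NNReal.coe_one, one_mul, Real.dist_eq]
    exact h x x.2 y y.2
  have h2 := h1.le_hausdorffMeasure_image zero_le_one univ
  rw [← isometry_subtype_coe.hausdorffMeasure_image (Or.inl zero_le_one), image_univ,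
    Subtype.range_coe, image_univ, hausdorffMeasure_real] at h2
  simp only [ENNReal.coe_one, ENNReal.one_rpow, one_mul] at h2
  convert h2 using 2
  ext; simp

theorem periodic_supportSlope (K : Set Plane) :
    Function.Periodic (supportSlope K) (2 * Real.pi) :=
  supportSlope_add_two_pi K

theorem contactSet_periodic (K : Set Plane) : Function.Periodic (contactSet K) (2 * Real.pi) :=
  contactSet_add_two_pi K

theorem hyperbolicLength_iUnion_contactSet_le {K : Set Plane} (hc : IsCompact K)
    (hn : K.Nonempty) (hb : K ⊆ Metric.ball 0 1) :
    hyperbolicLength (⋃ φ, contactSet K φ)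
      ≤ ENNReal.ofReal (∫ φ in (0 : ℝ)..2 * Real.pi, supportSlope K φ) := by
  have hcont := continuous_supportSlope hc hn hb
  set I := ∫ φ in (0 : ℝ)..2 * Real.pi, supportSlope K φ with hI
  have hperiod : ∀ x, ∫ φ in x..x + 2 * Real.pi, supportSlope K φ = I := fun x => by
    rw [(periodic_supportSlope K).intervalIntegral_add_eq x 0, zero_add]
  have hex : ∀ P : KleinDisk, ∃ φ, P.pt ∈ (⋃ φ, contactSet K φ) →
      P.pt ∈ contactSet K φ ∧ φ ∈ Ico 0 (2 * Real.pi) := fun P => by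
    by_cases hP : P.pt ∈ ⋃ φ, contactSet K φ
    · obtain ⟨φ, hφ⟩ := mem_iUnion.1 hP
      obtain ⟨y, hy, hyφ⟩ := (contactSet_periodic K).exists_mem_Ico₀ Real.two_pi_pos φ
      exact ⟨y, fun _ => ⟨hyφ ▸ hφ, hy⟩⟩
    · exact ⟨0, fun h => absurd h hP⟩
  choose θ hθ using hex
  -- The estimate of `dist_le_integral_supportSlope` is exactly an increment of this function.
  set f : KleinDisk → ℝ := fun P =>
    (∫ φ in (0 : ℝ)..θ P, supportSlope K φ) + busemann (θ P) P.pt with hf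
  set E : Set KleinDisk := KleinDisk.pt ⁻¹' ⋃ φ, contactSet K φ with hE
  have hsub : ∀ x y : ℝ, ∫ φ in x..y, supportSlope K φ
      = (∫ φ in (0 : ℝ)..y, supportSlope K φ) - ∫ φ in (0 : ℝ)..x, supportSlope K φ :=
    fun x y => (intervalIntegral.integral_interval_sub_left
      (hcont.intervalIntegrable _ _) (hcont.intervalIntegrable _ _)).symm
  have hlt : ∀ P ∈ E, ∀ Q ∈ E, θ P < θ Q → dist P Q ≤ f Q - f P := fun P hP Q hQ h => by
    have := dist_le_integral_supportSlope hc hb h (hθ P hP).1 (hθ Q hQ).1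
    rw [hsub] at this
    simp only [hf]; linarith
  -- Going on from `Q` around to `P` one period later, the distance is at most `I - (f Q - f P)`,
  -- and it is nonnegative.
  have hperP : ∀ P ∈ E, ∀ Q ∈ E, θ P ≤ θ Q → f Q - f P ≤ I := fun P hP Q hQ h => by
    have h1 : θ Q < θ P + 2 * Real.pi := by linarith [(hθ P hP).2.1, (hθ Q hQ).2.2]
    have := dist_le_integral_supportSlope hc hb h1 (hθ Q hQ).1
      (by rw [contactSet_add_two_pi]; exact (hθ P hP).1)
    have h2 := hperiod (θ P)
    rw [hsub] at this h2
    rw [busemann_add_two_pi] at this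
    have h3 := dist_nonneg (x := Q) (y := P)
    simp only [hf]; linarith
  have hexp : ∀ P ∈ E, ∀ Q ∈ E, dist P Q ≤ |f P - f Q| := by
    intro P hP Q hQ
    rcases lt_trichotomy (θ P) (θ Q) with h | h | h
    · rw [abs_sub_comm]; exact (hlt P hP Q hQ h).trans (le_abs_self _)
    · have h1 : f P - f Q = busemann (θ P) P.pt - busemann (θ P) Q.pt := by
        simp only [hf, h]; ring
      rw [h1, (KleinDisk.abs_busemann_sub_eq_dist_iff _ P Q).2]
      rw [← supportSlope_eq_of_mem (hθ P hP).1, h, supportSlope_eq_of_mem (hθ Q hQ).1]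
    · rw [dist_comm]; exact (hlt Q hQ P hP h).trans (le_abs_self _)
  refine (hausdorffMeasure_le_volume_image E f hexp).trans ((Real.volume_le_diam _).trans ?_)
  refine Metric.ediam_le ?_
  rintro _ ⟨P, hP, rfl⟩ _ ⟨Q, hQ, rfl⟩
  rw [edist_dist]
  apply ENNReal.ofReal_le_ofReal
  rw [Real.dist_eq, abs_le]
  rcases lt_trichotomy (θ P) (θ Q) with h | h | h
  · constructor <;> linarith [hlt P hP Q hQ h, hperP P hP Q hQ h.le, dist_nonneg (x := P) (y := Q)]
  · constructor <;> linarith [hperP P hP Q hQ h.le, hperP Q hQ P hP h.ge]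
  · constructor <;> linarith [hlt Q hQ P hP h, hperP Q hQ P hP h.le, dist_nonneg (x := Q) (y := P)]

/-! ### Boundary arcs -/

/-- Serves to carry Euclidean compactness over to the hyperbolic metric, which makes the boundary
arcs measurable. -/
theorem KleinDisk.continuous_mk :
    Continuous fun x : Metric.ball (0 : Plane) 1 => (⟨x, mem_ball_zero_iff.1 x.2⟩ : KleinDisk) := by
  rw [continuous_iff_continuousAt]
  intro x
  rw [ContinuousAt, tendsto_iff_dist_tendsto_zero]
  set p : Metric.ball (0 : Plane) 1 → KleinDisk := fun x => ⟨x, mem_ball_zero_iff.1 x.2⟩ with hp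
  have h0 : Continuous fun y => (p y).pt := continuous_subtype_val
  have h1 : Continuous fun y => coshDist (p y) (p x) := by
    unfold KleinDisk.coshDist
    refine Continuous.div (by fun_prop) (by fun_prop) fun y => ?_
    exact (mul_pos (Real.sqrt_pos.2 (p y).weight_pos) (Real.sqrt_pos.2 (p x).weight_pos)).ne'
  have h2 : Continuous fun y => dist (p y) (p x) :=
    Real.continuousOn_arcosh.comp_continuous h1 fun y => one_le_coshDist _ _
  have h3 := h2.tendsto x
  rwa [dist_self] at h3

theorem KleinDisk.isCompact_preimage_pt {E : Set Plane} (hE : IsCompact E)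
    (hb : E ⊆ Metric.ball 0 1) : IsCompact (KleinDisk.pt ⁻¹' E) := by
  have h1 : IsCompact ((↑) ⁻¹' E : Set (Metric.ball (0 : Plane) 1)) :=
    Topology.IsInducing.subtypeVal.isCompact_preimage' hE (by rwa [Subtype.range_coe])
  convert h1.image KleinDisk.continuous_mk using 1
  ext P
  constructor
  · intro h
    exact ⟨⟨P.pt, hb h⟩, h, rfl⟩
  · rintro ⟨x, hx, rfl⟩
    exact hx

/-- A connected set is at least as long as its projection by a Busemann function. -/
theorem ofReal_busemann_sub_le_hyperbolicLength {A : Set Plane} (hA : IsPreconnected A)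
    (hb : A ⊆ Metric.ball 0 1) {P Q : Plane} (hP : P ∈ A) (hQ : Q ∈ A) (φ : ℝ) :
    ENNReal.ofReal (busemann φ Q - busemann φ P) ≤ hyperbolicLength A := by
  have hL : LipschitzWith 1 fun P : KleinDisk => busemann φ P.pt :=
    LipschitzWith.of_dist_le_mul fun P Q => by
      rw [NNReal.coe_one, one_mul, Real.dist_eq]
      exact KleinDisk.abs_busemann_sub_le_dist φ P Q
  have h1 := hL.hausdorffMeasure_image_le zero_le_one (KleinDisk.pt ⁻¹' A)
  rw [ENNReal.coe_one, ENNReal.one_rpow, one_mul, hausdorffMeasure_real] at h1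
  refine le_trans ?_ h1
  rw [← Real.volume_Icc]
  apply measure_mono
  have h2 : busemann φ '' A ⊆ (fun P : KleinDisk => busemann φ P.pt) '' (KleinDisk.pt ⁻¹' A) := by
    rintro _ ⟨R, hR, rfl⟩
    exact ⟨⟨R, norm_lt_one_of_mem hb hR⟩, hR, rfl⟩
  exact ((hA.image _ ((continuousOn_busemann φ).mono hb)).Icc_subset (mem_image_of_mem _ hP)
    (mem_image_of_mem _ hQ)).trans h2

/-- The part of the boundary of `K` touched by the support lines from the points at infinity
between `x` and `y`. -/
def contactArc (K : Set Plane) (x y : ℝ) : Set Plane := ⋃ φ ∈ Icc x y, contactSet K φ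

theorem mem_contactArc {K : Set Plane} {x y : ℝ} {P : Plane} :
    P ∈ contactArc K x y ↔ ∃ φ ∈ Icc x y, P ∈ contactSet K φ := by
  simp only [contactArc, mem_iUnion, exists_prop]

theorem contactArc_subset (K : Set Plane) (x y : ℝ) : contactArc K x y ⊆ K :=
  iUnion₂_subset fun φ _ => contactSet_subset K φ

theorem isCompact_contactGraph {K : Set Plane} (hc : IsCompact K) (hb : K ⊆ Metric.ball 0 1)
    (x y : ℝ) : IsCompact {p : ℝ × Plane | p.1 ∈ Icc x y ∧ p.2 ∈ contactSet K p.1} := by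
  refine (isCompact_Icc (a := x) (b := y)).prod hc |>.of_isClosed_subset ?_ ?_
  · exact (isClosed_Icc.preimage continuous_fst).inter (isClosed_contactGraph hc hb)
  · rintro p ⟨h1, h2⟩
    exact ⟨h1, h2.1⟩

theorem isCompact_contactArc {K : Set Plane} (hc : IsCompact K) (hb : K ⊆ Metric.ball 0 1)
    (x y : ℝ) : IsCompact (contactArc K x y) := by
  convert (isCompact_contactGraph hc hb x y).image continuous_snd using 1
  ext P
  simp [mem_contactArc]

/-- The arc is swept out by convex, hence connected, fibres over an interval. By compactness of the
contact graph, a closed cover of the arc induces a closed cover of the interval; some fibre meets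
both parts, and its connectedness finishes. -/
theorem isPreconnected_contactArc {K : Set Plane} (hc : IsCompact K) (hv : Convex ℝ K)
    (hb : K ⊆ Metric.ball 0 1) (x y : ℝ) : IsPreconnected (contactArc K x y) := by
  rw [isPreconnected_closed_iff]
  rintro t t' ht ht' hcov ⟨P, hP, hPt⟩ ⟨P', hP', hPt'⟩
  have hT : ∀ s : Set Plane, IsClosed s →
      IsClosed {φ | φ ∈ Icc x y ∧ (contactSet K φ ∩ s).Nonempty} := fun s hs => by
    have h1 := ((isCompact_contactGraph hc hb x y).inter_right
      (hs.preimage continuous_snd)).image continuous_fst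
    convert h1.isClosed using 1
    ext φ
    simp only [mem_ofPred_eq, mem_image, mem_inter_iff, mem_preimage, Prod.exists,
      exists_and_right, exists_eq_right, Set.Nonempty]
    constructor
    · rintro ⟨h1, P, h2, h3⟩
      exact ⟨P, ⟨h1, h2⟩, h3⟩
    · rintro ⟨P, ⟨h1, h2⟩, h3⟩
      exact ⟨h1, P, h2, h3⟩
  obtain ⟨φ, hφ, hPφ⟩ := mem_contactArc.1 hP
  obtain ⟨φ', hφ', hPφ'⟩ := mem_contactArc.1 hP'
  have hsub : ∀ θ ∈ Icc x y, contactSet K θ ⊆ t ∪ t' := fun θ hθ Q hQ =>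
    hcov (mem_contactArc.2 ⟨θ, hθ, hQ⟩)
  obtain ⟨θ, hθ, ⟨-, h1⟩, -, h2⟩ := isPreconnected_closed_iff.1
    (isPreconnected_Icc (a := x) (b := y)) _ _ (hT t ht) (hT t' ht')
    (fun θ hθ => by
      obtain ⟨Q, hQ⟩ := contactSet_nonempty hc ⟨P, hPφ.1⟩ hb θ
      rcases hsub θ hθ hQ with h | h
      · exact Or.inl ⟨hθ, Q, hQ, h⟩
      · exact Or.inr ⟨hθ, Q, hQ, h⟩)
    ⟨φ, hφ, hφ, P, hPφ, hPt⟩ ⟨φ', hφ', hφ', P', hPφ', hPt'⟩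
  obtain ⟨Q, hQ, hQt⟩ := isPreconnected_closed_iff.1
    (convex_contactSet hc hv hb θ).isPreconnected t t' ht ht' (hsub θ hθ) h1 h2
  exact ⟨Q, mem_contactArc.2 ⟨θ, hθ, hQ⟩, hQt⟩

/-! ### Overlaps of boundary arcs -/

theorem exists_cross_neg_of_mem_interior {K : Set Plane} {P v : Plane} (hP : P ∈ interior K)
    (hv : v ≠ 0) : ∃ Q ∈ K, cross v (Q - P) < 0 := by
  set n : Plane := !₂[v 1, -v 0] with hn
  have h1 : Continuous fun t : ℝ => P + t • n := by fun_prop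
  have h2 : ∀ᶠ t in nhds (0 : ℝ), P + t • n ∈ interior K :=
    h1.continuousAt.eventually_mem (by simpa using isOpen_interior.mem_nhds hP)
  obtain ⟨t, ht, ht0⟩ := ((h2.filter_mono nhdsWithin_le_nhds).and
    (self_mem_nhdsWithin (s := Ioi (0 : ℝ)))).exists
  refine ⟨_, interior_subset ht, ?_⟩
  have h3 : 0 < ‖v‖ ^ 2 := by positivity
  rw [KleinDisk.normSq_eq] at h3
  have h4 : cross v (P + t • n - P) = -(t * (v 0 * v 0 + v 1 * v 1)) := by
    simp [cross, hn]; ring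
  rw [h4]
  have : 0 < t := ht0
  nlinarith [mul_pos this h3]

theorem sub_idealPoint_ne_zero {P : Plane} (hP : ‖P‖ < 1) (φ : ℝ) : P - idealPoint φ ≠ 0 := by
  intro h
  have h1 : ‖idealPoint φ‖ = 1 := by
    rw [← sq_eq_sq₀ (norm_nonneg _) zero_le_one, KleinDisk.normSq_eq]
    simp [idealPoint]
    linear_combination Real.sin_sq_add_cos_sq φ
  rw [sub_eq_zero.1 h] at hP
  linarith

theorem contactSet_subset_frontier {K : Set Plane} (hb : K ⊆ Metric.ball 0 1) (φ : ℝ) :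
    contactSet K φ ⊆ frontier K := by
  intro P hP
  refine ⟨subset_closure hP.1, fun hPi => ?_⟩
  have hP1 := norm_lt_one_of_mem hb hP.1
  obtain ⟨Q, hQ, h⟩ := exists_cross_neg_of_mem_interior hPi (sub_idealPoint_ne_zero hP1 φ)
  have h1 := (raySlope_le_raySlope_iff hP1 (norm_lt_one_of_mem hb hQ) φ).1 (hP.2 Q hQ)
  have h2 : cross (P - idealPoint φ) (Q - P) = cross (P - idealPoint φ) (Q - idealPoint φ) := by
    simp only [cross, PiLp.sub_apply]; ring
  linarith

/-! ### A point seen from two points at infinity -/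

theorem depth_add (a t : ℝ) (P : Plane) :
    depth (a + t) P = 1 - (Real.cos t * (1 - depth a P) + Real.sin t * lateral a P) := by
  simp only [depth, lateral, Real.cos_add, Real.sin_add]; ring

theorem lateral_add (a t : ℝ) (P : Plane) :
    lateral (a + t) P = Real.cos t * lateral a P - Real.sin t * (1 - depth a P) := by
  simp only [depth, lateral, Real.cos_add, Real.sin_add]; ring

theorem cross_sub_idealPoint_add (P Q : Plane) (a t : ℝ) :
    cross (P - idealPoint (a + t)) (Q - idealPoint (a + t))
      = (depth a P - depth a Q) * (Real.sin t - lateral a P)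
        - (lateral a Q - lateral a P) * (Real.cos t - 1 + depth a P) := by
  rw [cross_sub_idealPoint, depth_add, lateral_add, depth_add, lateral_add]
  linear_combination ((1 - depth a P) * lateral a Q - lateral a P * (1 - depth a Q))
    * Real.sin_sq_add_cos_sq t

/-- For `b - a` in `[0, 2π]` the sine factor is nonnegative, so the sign sits in a factor linear in
the sine and cosine of the half angle. -/
theorem cross_idealPoint_sub_left (P : Plane) (a b : ℝ) :
    cross (idealPoint a - P) (idealPoint b - P) = 2 * Real.sin ((b - a) / 2)
      * (depth a P * Real.cos ((b - a) / 2) - lateral a P * Real.sin ((b - a) / 2)) := by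
  set u := (b - a) / 2 with hu
  have hb : b = a + 2 * u := by rw [hu]; ring
  have h1 := Real.sin_sq_add_cos_sq a
  have h2 : Real.cos (2 * u) = 1 - 2 * Real.sin u ^ 2 := by
    rw [Real.cos_two_mul]; linear_combination 2 * Real.sin_sq_add_cos_sq u
  simp only [cross, idealPoint, PiLp.sub_apply, depth, lateral, hb, Real.cos_add, Real.sin_add,
    Real.sin_two_mul, h2]
  simp
  linear_combination 2 * Real.sin u * Real.cos u * h1

theorem cross_idealPoint_sub_right (P : Plane) (a b : ℝ) :
    cross (idealPoint a - P) (idealPoint b - P) = 2 * Real.sin ((b - a) / 2)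
      * (depth b P * Real.cos ((b - a) / 2) + lateral b P * Real.sin ((b - a) / 2)) := by
  have h := cross_idealPoint_sub_left P b a
  rw [show (a - b) / 2 = -((b - a) / 2) by ring, Real.sin_neg, Real.cos_neg] at h
  have h1 : cross (idealPoint a - P) (idealPoint b - P)
      = -cross (idealPoint b - P) (idealPoint a - P) := by simp only [cross]; ring
  rw [h1, h]; ring

theorem cross_idealPoint_sub_nonneg {P : Plane} (hP : ‖P‖ < 1) {a x b : ℝ} (hax : a ≤ x)
    (hxb : x ≤ b) (hba : b ≤ a + 2 * Real.pi)
    (h : 0 < cross (idealPoint a - P) (idealPoint b - P)) :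
    0 ≤ cross (idealPoint a - P) (idealPoint x - P) ∧
      0 ≤ cross (idealPoint x - P) (idealPoint b - P) := by
  have hu0 : 0 ≤ Real.sin ((b - a) / 2) :=
    Real.sin_nonneg_of_nonneg_of_le_pi (by linarith) (by linarith)
  have hu : 0 < Real.sin ((b - a) / 2) := by
    refine hu0.lt_of_ne fun h0 => ?_
    rw [cross_idealPoint_sub_left, ← h0] at h
    simp at h
  have hv : 0 ≤ Real.sin ((x - a) / 2) :=
    Real.sin_nonneg_of_nonneg_of_le_pi (by linarith) (by linarith)
  have hw : 0 ≤ Real.sin ((b - x) / 2) :=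
    Real.sin_nonneg_of_nonneg_of_le_pi (by linarith) (by linarith)
  constructor
  · rw [cross_idealPoint_sub_left] at h ⊢
    refine mul_nonneg (by linarith) (nonneg_of_mul_nonneg_right (a := Real.sin ((b - a) / 2)) ?_ hu)
    have h1 := pos_of_mul_pos_right h (by linarith)
    have h2 : Real.sin ((b - x) / 2) = Real.sin ((b - a) / 2) * Real.cos ((x - a) / 2)
        - Real.cos ((b - a) / 2) * Real.sin ((x - a) / 2) := by
      rw [← Real.sin_sub]; congr 1; ring
    have h3 := mul_nonneg (depth_pos hP a).le hw
    have h4 := mul_nonneg hv h1.le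
    rw [h2] at h3
    linarith
  · rw [cross_idealPoint_sub_right] at h ⊢
    refine mul_nonneg (by linarith) (nonneg_of_mul_nonneg_right (a := Real.sin ((b - a) / 2)) ?_ hu)
    have h1 := pos_of_mul_pos_right h (by linarith)
    have h2 : Real.sin ((x - a) / 2) = Real.sin ((b - a) / 2) * Real.cos ((b - x) / 2)
        - Real.cos ((b - a) / 2) * Real.sin ((b - x) / 2) := by
      rw [← Real.sin_sub]; congr 1; ring
    have h3 := mul_nonneg (depth_pos hP b).le hv
    have h4 := mul_nonneg hw h1.le
    rw [h2] at h3
    linarith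

theorem mem_contactSet_of_cross_pos {K : Set Plane} (hb : K ⊆ Metric.ball 0 1) {P : Plane}
    {a x b : ℝ} (hax : a ≤ x) (hxb : x ≤ b) (hba : b ≤ a + 2 * Real.pi)
    (ha : P ∈ contactSet K a) (hbP : P ∈ contactSet K b)
    (h : 0 < cross (idealPoint a - P) (idealPoint b - P)) : P ∈ contactSet K x := by
  have hP1 := norm_lt_one_of_mem hb ha.1
  refine ⟨ha.1, fun Q hQ => ?_⟩
  have hQ1 := norm_lt_one_of_mem hb hQ
  have h1 := (raySlope_le_raySlope_iff hP1 hQ1 a).1 (ha.2 Q hQ)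
  have h2 := (raySlope_le_raySlope_iff hP1 hQ1 b).1 (hbP.2 Q hQ)
  rw [raySlope_le_raySlope_iff hP1 hQ1]
  obtain ⟨h3, h4⟩ := cross_idealPoint_sub_nonneg hP1 hax hxb hba h
  -- By Cramer's rule the direction from `P` to the ideal point at `x` is a nonnegative combination
  -- of those at `a` and `b`, so the two support inequalities add up to the one at `x`.
  refine nonneg_of_mul_nonneg_right (a := cross (idealPoint a - P) (idealPoint b - P)) ?_ h
  have h5 := add_nonneg (mul_nonneg h4 h1) (mul_nonneg h3 h2)
  convert h5 using 1
  simp only [cross, PiLp.sub_apply]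
  ring

/-- Otherwise `P` lies on the chord joining the two ideal points. Seen from its two ends, `K` is on
opposite sides of this chord, hence inside it, and has no interior. -/
theorem cross_idealPoint_sub_ne_zero {K : Set Plane} (hb : K ⊆ Metric.ball 0 1)
    (hi : (interior K).Nonempty) {P : Plane} {a b : ℝ} (hab : a < b) (hba : b < a + 2 * Real.pi)
    (ha : P ∈ contactSet K a) (hbP : P ∈ contactSet K b) :
    cross (idealPoint a - P) (idealPoint b - P) ≠ 0 := by
  intro h
  have hP1 := norm_lt_one_of_mem hb ha.1
  rw [cross_idealPoint_sub_left] at h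
  set u := (b - a) / 2 with hu
  have hb' : b = a + 2 * u := by rw [hu]; ring
  have hsu : 0 < Real.sin u := Real.sin_pos_of_pos_of_lt_pi (by linarith) (by linarith)
  have h0 : depth a P * Real.cos u = lateral a P * Real.sin u := by
    have := (mul_eq_zero.1 h).resolve_left (by linarith)
    linarith
  have hd := depth_pos hP1 a
  have hw : 0 < 2 * depth a P - depth a P ^ 2 - lateral a P ^ 2 := by
    rw [← weight_eq]; nlinarith [norm_nonneg P]
  -- The right side is the depth of the ideal point at `b`, so `P` lies strictly between the ends of
  -- the chord and the two views are opposite.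
  have hk : depth a P < 2 * Real.sin u ^ 2 := by
    have h2 := Real.sin_sq_add_cos_sq u
    have h3 : (2 * depth a P - depth a P ^ 2 - lateral a P ^ 2) * Real.sin u ^ 2
        = depth a P * (2 * Real.sin u ^ 2 - depth a P) := by
      linear_combination (-(depth a P) ^ 2) * h2
        + (depth a P * Real.cos u + lateral a P * Real.sin u) * h0
    have h4 := mul_pos hw (pow_pos hsu 2)
    rw [h3] at h4
    have := pos_of_mul_pos_right h4 hd.le
    linarith
  have key : ∀ Q ∈ K, cross (P - idealPoint a) (Q - idealPoint a) = 0 := by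
    intro Q hQ
    have hQ1 := norm_lt_one_of_mem hb hQ
    have h1 := (raySlope_le_raySlope_iff hP1 hQ1 a).1 (ha.2 Q hQ)
    have h2 := (raySlope_le_raySlope_iff hP1 hQ1 b).1 (hbP.2 Q hQ)
    have h3 : depth a P * cross (P - idealPoint b) (Q - idealPoint b)
        = -((2 * Real.sin u ^ 2 - depth a P) * cross (P - idealPoint a) (Q - idealPoint a)) := by
      have e1 : Real.cos (2 * u) = 1 - 2 * Real.sin u ^ 2 := by
        rw [Real.cos_two_mul]; linear_combination 2 * Real.sin_sq_add_cos_sq u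
      rw [hb', cross_sub_idealPoint_add, e1, Real.sin_two_mul, cross_sub_idealPoint]
      linear_combination 2 * Real.sin u * (depth a P - depth a Q) * h0
    nlinarith [mul_nonneg hd.le h2]
  obtain ⟨X, hX⟩ := hi
  obtain ⟨Q, hQ, hneg⟩ := exists_cross_neg_of_mem_interior hX (sub_idealPoint_ne_zero hP1 a)
  have h1 := key Q hQ
  have h2 := key X (interior_subset hX)
  simp only [cross, PiLp.sub_apply] at h1 h2 hneg
  linarith

/-- The points at infinity whose support line touches `K` at a given point form an interval. -/
theorem mem_contactSet_or_mem_contactSet {K : Set Plane} (hb : K ⊆ Metric.ball 0 1)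
    (hi : (interior K).Nonempty) {P : Plane} {a x b y : ℝ} (hax : a ≤ x) (hxb : x ≤ b)
    (hby : b ≤ y) (hya : y ≤ a + 2 * Real.pi) (ha : P ∈ contactSet K a)
    (hbP : P ∈ contactSet K b) : P ∈ contactSet K x ∨ P ∈ contactSet K y := by
  rcases (hax.trans hxb).eq_or_lt with h | hab
  · have : x = a := le_antisymm (by linarith) hax
    exact Or.inl (this ▸ ha)
  rcases (hby.trans hya).eq_or_lt with h | hba
  · have : y = b := le_antisymm (by linarith) hby
    exact Or.inr (this ▸ hbP)
  -- The sign decides which arc is subtended by less than a half-turn at `P`: from `a` to `b`, which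
  -- contains `x`, or from `b` to `a + 2π`, which contains `y`.
  rcases (cross_idealPoint_sub_ne_zero hb hi hab hba ha hbP).lt_or_gt with h | h
  · refine Or.inr (mem_contactSet_of_cross_pos hb hby hya (by linarith) hbP
      (by rwa [contactSet_add_two_pi]) ?_)
    have h1 : idealPoint (a + 2 * Real.pi) = idealPoint a := by simp [idealPoint]
    rw [h1]
    simp only [cross] at h ⊢
    linarith
  · exact Or.inl (mem_contactSet_of_cross_pos hb hax hxb hba.le ha hbP h)

/-! ### The boundary is the union of the contact sets -/

theorem exists_idealPoint_eq {R : Plane} (hR : ‖R‖ = 1) : ∃ φ, idealPoint φ = R := by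
  have h1 : ‖(⟨R 0, R 1⟩ : ℂ)‖ = 1 := by
    rw [← sq_eq_sq₀ (norm_nonneg _) zero_le_one, Complex.sq_norm, Complex.normSq_mk,
      ← KleinDisk.normSq_eq, hR]
  have h2 := Complex.norm_mul_cos_add_sin_mul_I (⟨R 0, R 1⟩ : ℂ)
  rw [h1, Complex.ofReal_one, one_mul] at h2
  set φ := Complex.arg ⟨R 0, R 1⟩
  refine ⟨φ, ?_⟩
  have h3 := congrArg Complex.re h2
  have h4 := congrArg Complex.im h2
  simp [Complex.cos_ofReal_re, Complex.sin_ofReal_re] at h3 h4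
  ext i
  fin_cases i
  · simp [idealPoint, h3]
  · simp [idealPoint, h4]

theorem exists_idealPoint_eq_sub_smul {P v : Plane} (hP : ‖P‖ < 1) (hv : v ≠ 0) :
    ∃ φ, ∃ s : ℝ, 0 < s ∧ idealPoint φ = P - s • v := by
  have hv' : 0 < ‖v‖ := norm_pos_iff.2 hv
  have hcont : Continuous fun s : ℝ => ‖P - s • v‖ := by fun_prop
  have h0 : ‖P - (0 : ℝ) • v‖ ≤ 1 := by simpa using hP.le
  have h1 : 1 ≤ ‖P - (2 / ‖v‖) • v‖ := by
    have h2 := norm_sub_norm_le ((2 / ‖v‖) • v) P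
    rw [norm_smul, Real.norm_of_nonneg (by positivity), div_mul_cancel₀ _ hv'.ne',
      norm_sub_rev] at h2
    linarith
  obtain ⟨s, hs, hs1⟩ := intermediate_value_Icc (by positivity : (0 : ℝ) ≤ 2 / ‖v‖)
    hcont.continuousOn ⟨h0, h1⟩
  obtain ⟨φ, hφ⟩ := exists_idealPoint_eq hs1
  refine ⟨φ, s, hs.1.lt_of_ne fun h => ?_, hφ⟩
  subst h
  simp only [zero_smul, sub_zero] at hs1
  linarith

theorem frontier_eq_iUnion_contactSet {K : Set Plane} (hc : IsCompact K) (hv : Convex ℝ K)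
    (hb : K ⊆ Metric.ball 0 1) (hi : (interior K).Nonempty) :
    frontier K = ⋃ φ, contactSet K φ := by
  refine Subset.antisymm (fun P hP => ?_) (iUnion_subset (contactSet_subset_frontier hb))
  have hPK : P ∈ K := hc.isClosed.frontier_subset hP
  have hP1 := norm_lt_one_of_mem hb hPK
  obtain ⟨f, hf⟩ := geometric_hahn_banach_open_point hv.interior isOpen_interior hP.2
  have hfK : ∀ Q ∈ K, f Q ≤ f P := fun Q hQ => by
    have h1 : Q ∈ closure (interior K) := by
      rw [hv.closure_interior_eq_closure_of_nonempty_interior hi]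
      exact subset_closure hQ
    exact closure_minimal (fun x hx => (hf x hx).le)
      (isClosed_le f.continuous continuous_const) h1
  set e0 : Plane := !₂[1, 0]
  set e1 : Plane := !₂[0, 1]
  have hfe : ∀ Q : Plane, f Q = f e0 * Q 0 + f e1 * Q 1 := fun Q => by
    have h1 : Q = Q 0 • e0 + Q 1 • e1 := by
      ext i; fin_cases i <;> simp [e0, e1]
    conv_lhs => rw [h1]
    simp only [map_add, map_smul, smul_eq_mul]; ring
  -- The direction of the supporting line given by `f`, oriented so that `K` lies on its left. Going
  -- back from `P` along `v` to the unit circle gives the required ideal point.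
  set v : Plane := !₂[-f e1, f e0]
  have hcross : ∀ Q, cross v Q = -f Q := fun Q => by
    rw [hfe Q]; simp [cross, v]; ring
  have hv0 : v ≠ 0 := fun h => by
    obtain ⟨X, hX⟩ := hi
    have h1 := hcross (X - P)
    rw [h, map_sub] at h1
    have h2 := hf X hX
    simp [cross] at h1
    linarith
  obtain ⟨φ, s, hs, hφ⟩ := exists_idealPoint_eq_sub_smul hP1 hv0
  refine mem_iUnion.2 ⟨φ, hPK, fun Q hQ => ?_⟩
  rw [raySlope_le_raySlope_iff hP1 (norm_lt_one_of_mem hb hQ), hφ]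
  have h1 : cross (P - (P - s • v)) (Q - (P - s • v)) = s * cross v (Q - P) := by
    simp only [cross, PiLp.sub_apply, PiLp.smul_apply, smul_eq_mul]; ring
  rw [h1, hcross, map_sub]
  exact mul_nonneg hs.le (by linarith [hfK Q hQ])

/-! ### Lower bound of the boundary length -/

/-- The support slope and the slope of `P` agree at `y` and are both `C`-Lipschitz, so they differ
by at most `2 * C * (y - x)` on the interval. -/
theorem integral_supportSlope_le {K : Set Plane} (hc : IsCompact K) (hn : K.Nonempty)
    (hb : K ⊆ Metric.ball 0 1) {C : NNReal} (hC : ∀ P ∈ K, LipschitzWith C fun φ => raySlope φ P)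
    (hCh : LipschitzWith C (supportSlope K)) {P : Plane} {x y : ℝ} (hxy : x ≤ y)
    (hP : P ∈ contactSet K y) :
    ∫ θ in x..y, supportSlope K θ ≤ busemann x P - busemann y P + 2 * C * (y - x) ^ 2 := by
  have hP1 := norm_lt_one_of_mem hb hP.1
  have hcont := (continuous_raySlope_left hP1)
  have h1 : ∫ θ in x..y, supportSlope K θ ≤ ∫ θ in x..y, (raySlope θ P + 2 * C * (y - x)) := by
    refine intervalIntegral.integral_mono_on hxy
      ((continuous_supportSlope hc hn hb).intervalIntegrable _ _)
      ((hcont.add continuous_const).intervalIntegrable _ _) fun θ hθ => ?_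
    have h2 := hCh.le_add_mul θ y
    have h3 := (hC P hP.1).le_add_mul y θ
    have h4 := supportSlope_eq_of_mem hP
    rw [Real.dist_eq] at h2 h3
    rw [abs_of_nonneg (by linarith [hθ.2])] at h3
    rw [abs_of_nonpos (by linarith [hθ.2])] at h2
    have h5 : (C : ℝ) * (y - θ) ≤ C * (y - x) :=
      mul_le_mul_of_nonneg_left (by linarith [hθ.1]) C.2
    linarith
  rw [intervalIntegral.integral_add (hcont.intervalIntegrable _ _)
    (continuous_const.intervalIntegrable _ _), integral_raySlope hP1,
    intervalIntegral.integral_const, smul_eq_mul] at h1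
  linarith

/-- A point common to both arcs is also touched from `y` or from `w`, by
`mem_contactSet_or_mem_contactSet`; those contact sets have at most one point and are null. -/
theorem aedisjoint_contactArc {K : Set Plane} (hb : K ⊆ Metric.ball 0 1)
    (hi : (interior K).Nonempty) {x y z w : ℝ} (hyz : y ≤ z)
    (hwx : w ≤ x + 2 * Real.pi) (hy : (contactSet K y).Subsingleton)
    (hw : (contactSet K w).Subsingleton) :
    AEDisjoint (μH[1]) (KleinDisk.pt ⁻¹' contactArc K x y)
      (KleinDisk.pt ⁻¹' contactArc K z w) := by
  have hinj : Function.Injective KleinDisk.pt := fun P Q h => KleinDisk.ext h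
  have := Measure.nullSingletonClass_hausdorff KleinDisk zero_lt_one
  have h0 : ∀ {s : Set Plane}, s.Subsingleton → μH[1] (KleinDisk.pt ⁻¹' s) = 0 := fun hs =>
    (hs.preimage hinj).measure_zero _
  refine measure_mono_null ?_ (measure_union_null (h0 hy) (h0 hw))
  rintro P ⟨hP, hP'⟩
  obtain ⟨φ, hφ, hPφ⟩ := mem_contactArc.1 hP
  obtain ⟨φ', hφ', hPφ'⟩ := mem_contactArc.1 hP'
  exact mem_contactSet_or_mem_contactSet hb hi hφ.2 (hyz.trans hφ'.1) hφ'.2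
    (hwx.trans (by linarith [hφ.1])) hPφ hPφ'

theorem ofReal_integral_sub_le_hyperbolicLength_frontier {K : Set Plane} (hc : IsCompact K)
    (hv : Convex ℝ K) (hb : K ⊆ Metric.ball 0 1) (hi : (interior K).Nonempty) {C : NNReal}
    (hC : ∀ P ∈ K, LipschitzWith C fun φ => raySlope φ P) (hCh : LipschitzWith C (supportSlope K))
    {n : ℕ} (hn0 : 0 < n) :
    ENNReal.ofReal ((∫ φ in (0 : ℝ)..2 * Real.pi, supportSlope K φ)
      - 8 * C * Real.pi ^ 2 / n) ≤ hyperbolicLength (frontier K) := by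
  have hn : K.Nonempty := hi.mono interior_subset
  have hn0' : (0 : ℝ) < n := Nat.cast_pos.2 hn0
  set δ : ℝ := 2 * Real.pi / n with hδ
  have hδ0 : 0 ≤ δ := by positivity
  have hδn : n * δ = 2 * Real.pi := by rw [hδ]; field_simp
  -- A generic rotation of the subdivision makes all division angles have one-point contact sets.
  have hgood : ∀ᵐ t : ℝ, ∀ k : ℕ, (contactSet K (t + k * δ)).Subsingleton := ae_all_iff.2 fun k =>
    (measurePreserving_add_right volume (k * δ)).quasiMeasurePreserving.ae
      (ae_subsingleton_contactSet hc hn hb)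
  obtain ⟨t, ht⟩ := hgood.exists
  set x : ℕ → ℝ := fun k => t + k * δ with hx
  have hmono : Monotone x := fun i j hij => by
    have : (i : ℝ) * δ ≤ j * δ := mul_le_mul_of_nonneg_right (Nat.cast_le.2 hij) hδ0
    simp only [hx]; linarith
  have hstep : ∀ k, x (k + 1) - x k = δ := fun k => by simp only [hx]; push_cast; ring
  have hxn : x n = x 0 + 2 * Real.pi := by simp only [hx]; push_cast; rw [hδn]; ring
  choose p hp using fun k => contactSet_nonempty hc hn hb (x k)
  have hpn : p n = p 0 := by
    refine ht 0 ?_ (hp 0)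
    have h1 := hp n
    rwa [hxn, contactSet_add_two_pi] at h1
  set A : ℕ → Set KleinDisk := fun k => KleinDisk.pt ⁻¹' contactArc K (x k) (x (k + 1)) with hA
  have hAsub : ⋃ k ∈ Finset.range n, A k ⊆ KleinDisk.pt ⁻¹' frontier K :=
    iUnion₂_subset fun k _ => preimage_mono
      (iUnion₂_subset fun φ _ => contactSet_subset_frontier hb φ)
  have hdisj : ∀ i j : ℕ, i < j → j < n → AEDisjoint (μH[1]) (A i) (A j) := fun i j hij hj =>
    aedisjoint_contactArc hb hi (hmono hij)
      ((hmono (Nat.succ_le_of_lt hj)).trans (hxn.le.trans (by linarith [hmono (Nat.zero_le i)])))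
      (ht (i + 1)) (ht (j + 1))
  have hpair : Set.Pairwise (↑(Finset.range n)) (Function.onFun (AEDisjoint (μH[1])) A) := by
    intro i hi' j hj hij
    rcases hij.lt_or_gt with h | h
    · exact hdisj i j h (Finset.mem_range.1 hj)
    · exact (hdisj j i h (Finset.mem_range.1 hi')).symm
  have hmeas : ∀ k ∈ Finset.range n, NullMeasurableSet (A k) (μH[1]) := fun k _ =>
    (KleinDisk.isCompact_preimage_pt (isCompact_contactArc hc hb _ _)
      ((contactArc_subset K _ _).trans hb)).measurableSet.nullMeasurableSet
  -- The increments of `F` relate the integral over each arc to a Busemann difference at one fixed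
  -- angle; they sum to zero around the circle.
  set F : ℕ → ℝ := fun k => busemann (x k) (p k) with hF
  have hFn : F n = F 0 := by simp only [hF]; rw [hpn, hxn, busemann_add_two_pi]
  have harc : ∀ k ∈ Finset.range n,
      ENNReal.ofReal (busemann (x k) (p (k + 1)) - busemann (x k) (p k)) ≤ μH[1] (A k) :=
    fun k _ => ofReal_busemann_sub_le_hyperbolicLength (isPreconnected_contactArc hc hv hb _ _)
      ((contactArc_subset K _ _).trans hb)
      (mem_contactArc.2 ⟨x k, ⟨le_rfl, hmono k.le_succ⟩, hp k⟩)
      (mem_contactArc.2 ⟨x (k + 1), ⟨hmono k.le_succ, le_rfl⟩, hp (k + 1)⟩) _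
  have hreal : (∫ φ in (0 : ℝ)..2 * Real.pi, supportSlope K φ) - 8 * C * Real.pi ^ 2 / n
      ≤ ∑ k ∈ Finset.range n, (busemann (x k) (p (k + 1)) - busemann (x k) (p k)) := by
    have h1 : ∑ k ∈ Finset.range n, ∫ θ in x k..x (k + 1), supportSlope K θ
        = ∫ φ in (0 : ℝ)..2 * Real.pi, supportSlope K φ := by
      rw [intervalIntegral.sum_integral_adjacent_intervals fun k _ =>
        (continuous_supportSlope hc hn hb).intervalIntegrable _ _, hxn,
        (periodic_supportSlope K).intervalIntegral_add_eq (x 0) 0, zero_add]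
    have h2 : ∀ k ∈ Finset.range n, (∫ θ in x k..x (k + 1), supportSlope K θ)
        ≤ (busemann (x k) (p (k + 1)) - busemann (x k) (p k)) - (F (k + 1) - F k)
          + 2 * C * δ ^ 2 := fun k _ => by
      have h3 := integral_supportSlope_le hc hn hb hC hCh (hmono k.le_succ) (hp (k + 1))
      rw [Nat.succ_eq_add_one, hstep] at h3
      simp only [hF]
      linarith
    have h3 := Finset.sum_le_sum h2
    rw [h1, Finset.sum_add_distrib, Finset.sum_sub_distrib, Finset.sum_range_sub, hFn, sub_self,
      sub_zero, Finset.sum_const, Finset.card_range, nsmul_eq_mul] at h3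
    have h4 : (n : ℝ) * (2 * C * δ ^ 2) = 8 * C * Real.pi ^ 2 / n := by
      rw [hδ]; field_simp; ring
    linarith
  calc _ ≤ ENNReal.ofReal (∑ k ∈ Finset.range n,
        (busemann (x k) (p (k + 1)) - busemann (x k) (p k))) := ENNReal.ofReal_le_ofReal hreal
    _ ≤ ∑ k ∈ Finset.range n,
        ENNReal.ofReal (busemann (x k) (p (k + 1)) - busemann (x k) (p k)) :=
      Finset.le_sum_of_subadditive _ ENNReal.ofReal_zero.le
        (fun _ _ => ENNReal.ofReal_add_le) _ _
    _ ≤ ∑ k ∈ Finset.range n, μH[1] (A k) := Finset.sum_le_sum harc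
    _ = μH[1] (⋃ k ∈ Finset.range n, A k) := (measure_biUnion_finset₀ hpair hmeas).symm
    _ ≤ hyperbolicLength (frontier K) := measure_mono hAsub

theorem hyperbolicLength_frontier_eq {K : Set Plane} (hc : IsCompact K) (hv : Convex ℝ K)
    (hb : K ⊆ Metric.ball 0 1) (hi : (interior K).Nonempty) :
    hyperbolicLength (frontier K)
      = ENNReal.ofReal (∫ φ in (0 : ℝ)..2 * Real.pi, supportSlope K φ) := by
  have hn : K.Nonempty := hi.mono interior_subset
  apply le_antisymm
  · rw [frontier_eq_iUnion_contactSet hc hv hb hi]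
    exact hyperbolicLength_iUnion_contactSet_le hc hn hb
  · obtain ⟨C, hC, hCh⟩ := exists_lipschitzWith_raySlope hc hn hb
    have h1 := (tendsto_const_nhds (x := ∫ φ in (0 : ℝ)..2 * Real.pi, supportSlope K φ)).sub
      (tendsto_const_div_atTop_nhds_zero_nat (8 * C * Real.pi ^ 2))
    rw [sub_zero] at h1
    refine le_of_tendsto (ENNReal.tendsto_ofReal h1) ?_
    filter_upwards [Filter.eventually_gt_atTop 0] with n hn0
    exact ofReal_integral_sub_le_hyperbolicLength_frontier hc hv hb hi hC hCh hn0

/-! ### Degenerate two-gons -/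

theorem exists_subset_segment {K : Set Plane} (hc : IsCompact K) (hn : K.Nonempty)
    (hv : Convex ℝ K) (hi : ¬(interior K).Nonempty) :
    ∃ P ∈ K, ∃ Q ∈ K, K ⊆ segment ℝ P Q := by
  have hcol : Collinear ℝ K := by
    rw [collinear_iff_finrank_le_one]
    by_contra h
    have h1 : vectorSpan ℝ K = ⊤ := Submodule.eq_top_of_finrank_eq (le_antisymm
      (Submodule.finrank_le _) (by rw [finrank_euclideanSpace_fin]; omega))
    rw [hv.interior_nonempty_iff_affineSpan_eq_top,
      AffineSubspace.affineSpan_eq_top_iff_vectorSpan_eq_top_of_nonempty ℝ _ _ hn] at hi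
    exact hi h1
  obtain ⟨p, v, hpv⟩ := (collinear_iff_exists_forall_eq_smul_vadd K).1 hcol
  have hcont : Continuous fun X : Plane => ⟪v, X⟫ := by fun_prop
  obtain ⟨P, hP, hmin⟩ := hc.exists_isMinOn hn hcont.continuousOn
  obtain ⟨Q, hQ, hmax⟩ := hc.exists_isMaxOn hn hcont.continuousOn
  refine ⟨P, hP, Q, hQ, fun X hX => ?_⟩
  obtain ⟨a, ha⟩ := hpv P hP
  obtain ⟨b, hbQ⟩ := hpv Q hQ
  obtain ⟨c, hcX⟩ := hpv X hX
  rcases eq_or_ne v 0 with rfl | hv0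
  · simp only [smul_zero, zero_vadd] at ha hbQ hcX
    rw [hcX, ha]
    exact left_mem_segment ℝ _ _
  · have hvv : 0 < ⟪v, v⟫ := real_inner_self_pos.2 hv0
    have h1 : ⟪v, P⟫ ≤ ⟪v, X⟫ := hmin hX
    have h2 : ⟪v, X⟫ ≤ ⟪v, Q⟫ := hmax hX
    rw [ha, hcX, vadd_eq_add, vadd_eq_add, inner_add_right, inner_add_right,
      real_inner_smul_right, real_inner_smul_right] at h1
    rw [hbQ, hcX, vadd_eq_add, vadd_eq_add, inner_add_right, inner_add_right,
      real_inner_smul_right, real_inner_smul_right] at h2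
    have h3 : a ≤ c := le_of_mul_le_mul_right (by linarith) hvv
    have h4 : c ≤ b := le_of_mul_le_mul_right (by linarith) hvv
    have h5 : ∀ r : ℝ, r • v +ᵥ p = AffineMap.lineMap p (p + v) r := fun r => by
      simp [AffineMap.lineMap_apply]
    rw [ha, hbQ, hcX, h5, h5, h5, ← image_segment]
    refine mem_image_of_mem _ ?_
    rw [segment_eq_Icc (h3.trans h4)]
    exact ⟨h3, h4⟩

/-- The slope is a quotient of affine functions with positive denominator, so on a segment it is
largest at an endpoint. -/
theorem mem_contactSet_of_subset_segment {K : Set Plane} (hb : K ⊆ Metric.ball 0 1) {P Q : Plane}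
    (hP : P ∈ K) (hQ : Q ∈ K) (hK : K ⊆ segment ℝ P Q) {φ : ℝ}
    (h : raySlope φ Q ≤ raySlope φ P) : P ∈ contactSet K φ := by
  refine ⟨hP, fun X hX => ?_⟩
  have hX1 := depth_pos (norm_lt_one_of_mem hb hX) φ
  have hP1 := depth_pos (norm_lt_one_of_mem hb hP) φ
  have hQ1 := depth_pos (norm_lt_one_of_mem hb hQ) φ
  obtain ⟨s, t, hs, ht, hst, rfl⟩ := hK hX
  have h1 : lateral φ Q ≤ raySlope φ P * depth φ Q := by
    rwa [raySlope, div_le_iff₀ hQ1] at h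
  have h2 : lateral φ P = raySlope φ P * depth φ P := by
    rw [raySlope, div_mul_cancel₀ _ hP1.ne']
  have h3 : lateral φ (s • P + t • Q) = s * lateral φ P + t * lateral φ Q := by
    simp only [lateral, PiLp.add_apply, PiLp.smul_apply, smul_eq_mul]; ring
  have h4 : depth φ (s • P + t • Q) = s * depth φ P + t * depth φ Q := by
    simp only [depth, PiLp.add_apply, PiLp.smul_apply, smul_eq_mul]
    linear_combination -hst
  rw [raySlope, div_le_iff₀ hX1, h3, h4]
  nlinarith [mul_le_mul_of_nonneg_left h1 ht]

theorem Function.Periodic.exists_forall_le {f : ℝ → ℝ} {c : ℝ} (hf : Function.Periodic f c)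
    (hc : 0 < c) (hcont : Continuous f) : ∃ x, ∀ y, f y ≤ f x := by
  obtain ⟨x, -, hx⟩ := isCompact_Icc.exists_isMaxOn (nonempty_Icc.2 hc.le) hcont.continuousOn
  refine ⟨x, fun y => ?_⟩
  obtain ⟨z, hz, hyz⟩ := hf.exists_mem_Ico₀ hc y
  rw [hyz]
  exact hx (Ico_subset_Icc_self hz)

/-- Two points of the disk are collinear with exactly two points at infinity. -/
theorem exists_raySlope_eq {P Q : Plane} (hP : ‖P‖ < 1) (hQ : ‖Q‖ < 1) (hPQ : P ≠ Q) :
    ∃ x y, x < y ∧ y < x + 2 * Real.pi ∧ raySlope x P = raySlope x Q ∧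
      raySlope y P = raySlope y Q := by
  set D : ℝ → ℝ := fun θ => busemann θ Q - busemann θ P with hD
  have hD' : ∀ θ, HasDerivAt D (raySlope θ P - raySlope θ Q) θ := fun θ =>
    ((hasDerivAt_busemann hQ θ).sub (hasDerivAt_busemann hP θ)).congr_deriv (by ring)
  have hcont : Continuous D := continuous_iff_continuousAt.2 fun θ => (hD' θ).continuousAt
  have hper : Function.Periodic D (2 * Real.pi) := fun θ => by
    simp only [hD, busemann_add_two_pi]
  -- Critical points of `D` are the ideal points collinear with `P` and `Q`; a maximum and a minimum
  -- give two. If these coincided, `D` would be constant and `P = Q`.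
  obtain ⟨x, hx⟩ := hper.exists_forall_le Real.two_pi_pos hcont
  obtain ⟨z, hz⟩ := (show Function.Periodic (-D) (2 * Real.pi) from
    fun θ => congrArg Neg.neg (hper θ)).exists_forall_le
    Real.two_pi_pos hcont.neg
  obtain ⟨y, hy, hzy⟩ := hper.exists_mem_Ico Real.two_pi_pos z x
  have hymin : ∀ θ, D y ≤ D θ := fun θ => by
    have := hz θ
    simp only [Pi.neg_apply] at this
    rw [← hzy]; linarith
  have hx0 : raySlope x P - raySlope x Q = 0 :=
    IsLocalMax.hasDerivAt_eq_zero (Filter.Eventually.of_forall hx) (hD' x)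
  have hy0 : raySlope y P - raySlope y Q = 0 :=
    IsLocalMin.hasDerivAt_eq_zero (Filter.Eventually.of_forall hymin) (hD' y)
  refine ⟨x, y, hy.1.lt_of_ne fun h => hPQ ?_, hy.2, by linarith, by linarith⟩
  subst h
  refine eq_of_raySlope_eq_on hP hQ zero_lt_one fun θ _ => ?_
  have h1 : D = fun _ => D x := funext fun θ => le_antisymm (hx θ) (hymin θ)
  have h2 := hD' θ
  rw [h1] at h2
  linarith [h2.unique (hasDerivAt_const θ (D x))]

/-- The order of the slopes of two points is constant on an arc between the two points at infinity
collinear with them. -/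
theorem exists_cross_eq_mul_sin {P Q : Plane} {x y : ℝ} (hxy : x < y) (hyx : y < x + 2 * Real.pi)
    (hx : cross (P - idealPoint x) (Q - idealPoint x) = 0)
    (hy : cross (P - idealPoint y) (Q - idealPoint y) = 0) :
    ∃ c : ℝ, ∀ θ, cross (P - idealPoint θ) (Q - idealPoint θ)
      = c * (Real.sin ((θ - x) / 2) * Real.sin ((y - θ) / 2)) := by
  have key : ∀ u, cross (P - idealPoint (x + 2 * u)) (Q - idealPoint (x + 2 * u))
      = 2 * Real.sin u * ((depth x P - depth x Q) * Real.cos u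
        + (lateral x Q - lateral x P) * Real.sin u) := fun u => by
    rw [cross_sub_idealPoint_add, Real.sin_two_mul, Real.cos_two_mul']
    rw [cross_sub_idealPoint] at hx
    linear_combination hx + (lateral x P - lateral x Q) * Real.sin_sq_add_cos_sq u
  set w := (y - x) / 2 with hw
  have hsw : 0 < Real.sin w := Real.sin_pos_of_pos_of_lt_pi (by linarith) (by linarith)
  have hy' := key w
  rw [show x + 2 * w = y by rw [hw]; ring, hy] at hy'
  have h0 : (depth x P - depth x Q) * Real.cos w + (lateral x Q - lateral x P) * Real.sin w = 0 :=
    (mul_eq_zero.1 hy'.symm).resolve_left (by positivity)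
  -- A combination of `cos u` and `sin u` vanishing at `w` is a multiple of `sin (w - u)`; its value
  -- at `u = 0` fixes the constant.
  refine ⟨2 * (depth x P - depth x Q) / Real.sin w, fun θ => ?_⟩
  set u := (θ - x) / 2 with hu
  rw [show (y - θ) / 2 = w - u by rw [hw, hu]; ring, Real.sin_sub]
  have h1 := key u
  rw [show x + 2 * u = θ by rw [hu]; ring] at h1
  rw [h1]
  field_simp
  linear_combination (Real.sin u) ^ 2 * h0

theorem integral_supportSlope_eq_of_mem {K : Set Plane} (hb : K ⊆ Metric.ball 0 1) {P : Plane}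
    (hP : P ∈ K) {x y : ℝ} (hxy : x ≤ y) (h : ∀ θ ∈ Icc x y, P ∈ contactSet K θ) :
    ∫ θ in x..y, supportSlope K θ = busemann x P - busemann y P := by
  rw [← integral_raySlope (norm_lt_one_of_mem hb hP)]
  refine intervalIntegral.integral_congr fun θ hθ => ?_
  rw [uIcc_of_le hxy] at hθ
  exact supportSlope_eq_of_mem (h θ hθ)

/-- One endpoint is touched throughout `[x, y]` and the other throughout `[y, x + 2π]`, the sign of
`c` deciding which. The integral is then a sum of two Busemann differences of `P` and `Q`, at `x`
and at `y`, each at most their distance. -/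
theorem integral_supportSlope_le_of_subset_segment {K : Set Plane} (hc : IsCompact K)
    (hb : K ⊆ Metric.ball 0 1) {P Q : KleinDisk} (hP : P.pt ∈ K) (hQ : Q.pt ∈ K)
    (hK : K ⊆ segment ℝ P.pt Q.pt) {x y : ℝ} (hxy : x < y) (hyx : y < x + 2 * Real.pi)
    (hx : raySlope x P.pt = raySlope x Q.pt) (hy : raySlope y P.pt = raySlope y Q.pt) :
    ∫ θ in (0 : ℝ)..2 * Real.pi, supportSlope K θ ≤ 2 * dist P Q := by
  have hint : ∀ a b, IntervalIntegrable (supportSlope K) volume a b := fun a b =>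
    (continuous_supportSlope hc ⟨_, hP⟩ hb).intervalIntegrable a b
  have hI : (∫ θ in x..y, supportSlope K θ) + ∫ θ in y..x + 2 * Real.pi, supportSlope K θ
      = ∫ θ in (0 : ℝ)..2 * Real.pi, supportSlope K θ := by
    rw [intervalIntegral.integral_add_adjacent_intervals (hint _ _) (hint _ _),
      (periodic_supportSlope K).intervalIntegral_add_eq x 0, zero_add]
  have hBx := abs_le.1 (KleinDisk.abs_busemann_sub_le_dist x P Q)
  have hBy := abs_le.1 (KleinDisk.abs_busemann_sub_le_dist y P Q)
  obtain ⟨c, hcr⟩ := exists_cross_eq_mul_sin hxy hyx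
    ((raySlope_eq_raySlope_iff P.norm_lt Q.norm_lt x).1 hx.symm)
    ((raySlope_eq_raySlope_iff P.norm_lt Q.norm_lt y).1 hy.symm)
  have hs1 : ∀ θ ∈ Icc x y, 0 ≤ Real.sin ((θ - x) / 2) * Real.sin ((y - θ) / 2) := fun θ hθ =>
    mul_nonneg (Real.sin_nonneg_of_nonneg_of_le_pi (by linarith [hθ.1]) (by linarith [hθ.2]))
      (Real.sin_nonneg_of_nonneg_of_le_pi (by linarith [hθ.2]) (by linarith [hθ.1]))
  have hs2 : ∀ θ ∈ Icc y (x + 2 * Real.pi),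
      Real.sin ((θ - x) / 2) * Real.sin ((y - θ) / 2) ≤ 0 := fun θ hθ =>
    mul_nonpos_of_nonneg_of_nonpos
      (Real.sin_nonneg_of_nonneg_of_le_pi (by linarith [hθ.1]) (by linarith [hθ.2]))
      (Real.sin_nonpos_of_nonpos_of_neg_pi_le (by linarith [hθ.1]) (by linarith [hθ.2]))
  have hK' : K ⊆ segment ℝ Q.pt P.pt := by rwa [segment_symm]
  have hPc : ∀ θ, 0 ≤ cross (P.pt - idealPoint θ) (Q.pt - idealPoint θ) →
      P.pt ∈ contactSet K θ := fun θ h => mem_contactSet_of_subset_segment hb hP hQ hK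
    ((raySlope_le_raySlope_iff P.norm_lt Q.norm_lt θ).2 h)
  have hQc : ∀ θ, cross (P.pt - idealPoint θ) (Q.pt - idealPoint θ) ≤ 0 →
      Q.pt ∈ contactSet K θ := fun θ h => mem_contactSet_of_subset_segment hb hQ hP hK'
    ((raySlope_le_raySlope_iff Q.norm_lt P.norm_lt θ).2 (by simp only [cross] at h ⊢; linarith))
  rcases le_total 0 c with h | h
  · rw [← hI, integral_supportSlope_eq_of_mem hb hP hxy.le fun θ hθ => hPc θ
        (by rw [hcr]; exact mul_nonneg h (hs1 θ hθ)),
      integral_supportSlope_eq_of_mem hb hQ hyx.le fun θ hθ => hQc θ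
        (by rw [hcr]; exact mul_nonpos_of_nonneg_of_nonpos h (hs2 θ hθ)), busemann_add_two_pi]
    linarith
  · rw [← hI, integral_supportSlope_eq_of_mem hb hQ hxy.le fun θ hθ => hQc θ
        (by rw [hcr]; exact mul_nonpos_of_nonpos_of_nonneg h (hs1 θ hθ)),
      integral_supportSlope_eq_of_mem hb hP hyx.le fun θ hθ => hPc θ
        (by rw [hcr]; exact mul_nonneg_of_nonpos_of_nonpos h (hs2 θ hθ)), busemann_add_two_pi]
    linarith

theorem two_mul_hyperbolicLength_le {K : Set Plane} (hc : IsCompact K) (hb : K ⊆ Metric.ball 0 1)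
    {x y : ℝ} (hxy : x < y) (hyx : y < x + 2 * Real.pi) (hKx : K ⊆ contactSet K x)
    (hKy : K ⊆ contactSet K y) :
    2 * hyperbolicLength K
      ≤ ENNReal.ofReal (∫ θ in (0 : ℝ)..2 * Real.pi, supportSlope K θ) := by
  rcases K.eq_empty_or_nonempty with rfl | hn
  · simp [hyperbolicLength]
  set I := ∫ θ in (0 : ℝ)..2 * Real.pi, supportSlope K θ with hI
  have hint : ∀ a b, IntervalIntegrable (supportSlope K) volume a b := fun a b =>
    (continuous_supportSlope hc hn hb).intervalIntegrable a b
  have hsum : (∫ θ in x..y, supportSlope K θ) + ∫ θ in y..x + 2 * Real.pi, supportSlope K θ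
      = I := by
    rw [intervalIntegral.integral_add_adjacent_intervals (hint _ _) (hint _ _),
      (periodic_supportSlope K).intervalIntegral_add_eq x 0, zero_add]
  have hdist : ∀ X ∈ KleinDisk.pt ⁻¹' K, ∀ Y ∈ KleinDisk.pt ⁻¹' K,
      |busemann x X.pt - busemann x Y.pt| = dist X Y := fun X hX Y hY => by
    rw [KleinDisk.abs_busemann_sub_eq_dist_iff, ← supportSlope_eq_of_mem (hKx hX),
      supportSlope_eq_of_mem (hKx hY)]
  -- The distance estimates from `x` to `y` and from `y` to `x + 2π` are added; their Busemann terms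
  -- cancel.
  have hhalf : ∀ X ∈ KleinDisk.pt ⁻¹' K, ∀ Y ∈ KleinDisk.pt ⁻¹' K, dist X Y ≤ I / 2 :=
    fun X hX Y hY => by
      have h1 := dist_le_integral_supportSlope hc hb hxy (hKx hX) (hKy hY)
      have h2 := dist_le_integral_supportSlope hc hb hyx (hKy hY)
        (by rw [contactSet_add_two_pi]; exact hKx hX)
      rw [busemann_add_two_pi, dist_comm] at h2
      linarith
  have h1 : hyperbolicLength K ≤ ENNReal.ofReal (I / 2) := by
    have h2 := hausdorffMeasure_le_volume_image (KleinDisk.pt ⁻¹' K)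
      (fun X : KleinDisk => busemann x X.pt) fun X hX Y hY => (hdist X hX Y hY).ge
    rw [hyperbolicLength]
    refine h2.trans ((Real.volume_le_diam _).trans ?_)
    refine Metric.ediam_le ?_
    rintro _ ⟨X, hX, rfl⟩ _ ⟨Y, hY, rfl⟩
    rw [edist_dist, Real.dist_eq, hdist X hX Y hY]
    exact ENNReal.ofReal_le_ofReal (hhalf X hX Y hY)
  calc 2 * hyperbolicLength K ≤ ENNReal.ofReal 2 * ENNReal.ofReal (I / 2) := by
        rw [ENNReal.ofReal_ofNat]; gcongr
    _ = ENNReal.ofReal I := by rw [← ENNReal.ofReal_mul zero_le_two]; congr 1; ring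

theorem two_mul_hyperbolicLength_eq {K : Set Plane} (hc : IsCompact K) (hn : K.Nonempty)
    (hv : Convex ℝ K) (hb : K ⊆ Metric.ball 0 1) (hi : ¬(interior K).Nonempty) :
    2 * hyperbolicLength K
      = ENNReal.ofReal (∫ θ in (0 : ℝ)..2 * Real.pi, supportSlope K θ) := by
  obtain ⟨P, hP, Q, hQ, hK⟩ := exists_subset_segment hc hn hv hi
  have hP1 := norm_lt_one_of_mem hb hP
  have hQ1 := norm_lt_one_of_mem hb hQ
  rcases eq_or_ne P Q with rfl | hPQ
  · rw [segment_same] at hK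
    have := Measure.nullSingletonClass_hausdorff KleinDisk zero_lt_one
    have hinj : Function.Injective KleinDisk.pt := fun P Q h => KleinDisk.ext h
    have h0 : hyperbolicLength K = 0 :=
      ((subsingleton_singleton.anti hK).preimage hinj).measure_zero _
    rw [h0, mul_zero, integral_supportSlope_eq_of_mem hb hP Real.two_pi_pos.le fun θ _ =>
      mem_contactSet_of_subset_segment hb hP hP (by rwa [segment_same]) le_rfl]
    have h1 := busemann_add_two_pi 0 P
    rw [zero_add] at h1
    rw [h1, sub_self, ENNReal.ofReal_zero]
  obtain ⟨x, y, hxy, hyx, hx, hy⟩ := exists_raySlope_eq hP1 hQ1 hPQ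
  have hcontact : ∀ θ, raySlope θ P = raySlope θ Q → K ⊆ contactSet K θ := fun θ h =>
    hK.trans ((convex_contactSet hc hv hb θ).segment_subset
      (mem_contactSet_of_subset_segment hb hP hQ hK h.ge)
      (mem_contactSet_of_subset_segment hb hQ hP (by rwa [segment_symm]) h.le))
  refine le_antisymm (two_mul_hyperbolicLength_le hc hb hxy hyx (hcontact x hx) (hcontact y hy)) ?_
  set P' : KleinDisk := ⟨P, hP1⟩
  set Q' : KleinDisk := ⟨Q, hQ1⟩
  have h1 : ∫ θ in (0 : ℝ)..2 * Real.pi, supportSlope K θ ≤ 2 * dist P' Q' :=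
    integral_supportSlope_le_of_subset_segment hc hb (P := P') (Q := Q') hP hQ hK hxy hyx hx hy
  have h2 : ENNReal.ofReal (dist P' Q') ≤ hyperbolicLength K := by
    rw [← (KleinDisk.abs_busemann_sub_eq_dist_iff x P' Q').2 hx]
    rcases abs_choice (busemann x P'.pt - busemann x Q'.pt) with h | h
    · rw [h]
      exact ofReal_busemann_sub_le_hyperbolicLength hv.isPreconnected hb hQ hP x
    · rw [h, neg_sub]
      exact ofReal_busemann_sub_le_hyperbolicLength hv.isPreconnected hb hP hQ x
  calc _ ≤ ENNReal.ofReal (2 * dist P' Q') := ENNReal.ofReal_le_ofReal h1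
    _ = 2 * ENNReal.ofReal (dist P' Q') := by
      rw [ENNReal.ofReal_mul zero_le_two, ENNReal.ofReal_ofNat]
    _ ≤ 2 * hyperbolicLength K := by gcongr

/-! ### The one-sided projective Cauchy formula -/

theorem hyperbolicPerimeter_eq {K : Set Plane} (hc : IsCompact K) (hn : K.Nonempty)
    (hv : Convex ℝ K) (hb : K ⊆ Metric.ball 0 1) :
    hyperbolicPerimeter K
      = ENNReal.ofReal (∫ θ in (0 : ℝ)..2 * Real.pi, supportSlope K θ) := by
  rw [hyperbolicPerimeter]
  split_ifs with hi
  · exact hyperbolicLength_frontier_eq hc hv hb hi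
  · exact two_mul_hyperbolicLength_eq hc hn hv hb hi

/-- The slope of a single point integrates to zero over a period. The sign is needed because
`ENNReal.ofReal` truncates negative numbers. -/
theorem integral_supportSlope_nonneg {K : Set Plane} (hc : IsCompact K) (hn : K.Nonempty)
    (hb : K ⊆ Metric.ball 0 1) : 0 ≤ ∫ θ in (0 : ℝ)..2 * Real.pi, supportSlope K θ := by
  obtain ⟨P, hP⟩ := hn
  have h1 := busemann_sub_le_integral hc hb hP Real.two_pi_pos.le
  have h2 := busemann_add_two_pi 0 P
  rw [zero_add] at h2
  rwa [h2, sub_self] at h1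

/-- `h φ` is the signed coordinate on the `φ`-normal of its intersection with the right-hand
support line of `K` from the point at infinity with central angle `φ`. -/
theorem theorem4p2 (K : ConvexBody Plane) (hK : (K : Set Plane) ⊆ Metric.ball 0 1) :
    (∀ φ : ℝ, ∃! L : AffineSubspace ℝ Plane, IsRightSupportLine K φ L) ∧
    ∃ h : ℝ → ℝ,
      (∀ (φ : ℝ) (L : AffineSubspace ℝ Plane), IsRightSupportLine K φ L →
        ∀ x : ℝ, x • normalDir φ ∈ L ↔ x = h φ) ∧
      (∀ φ : ℝ, h φ = Real.cot (psi₁ K φ)) ∧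
      IntervalIntegrable h MeasureTheory.volume 0 (2 * Real.pi) ∧
      hyperbolicPerimeter K ≠ ⊤ ∧
      (hyperbolicPerimeter K).toReal = (∫ φ in (0 : ℝ)..(2 * Real.pi), h φ) ∧
      (hyperbolicPerimeter K).toReal =
        (∫ φ in (0 : ℝ)..(2 * Real.pi), Real.cot (psi₁ K φ)) := by
  have hc := K.isCompact
  have hn := K.nonempty
  have hper := hyperbolicPerimeter_eq hc hn K.convex hK
  have hreal : (hyperbolicPerimeter K).toReal
      = ∫ φ in (0 : ℝ)..(2 * Real.pi), supportSlope K φ := by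
    rw [hper, ENNReal.toReal_ofReal (integral_supportSlope_nonneg hc hn hK)]
  refine ⟨existsUnique_isRightSupportLine hc hn hK, supportSlope K,
    fun φ L hL x => smul_normalDir_mem_supportLine_iff hK hL x,
    fun φ => (cot_psi₁_eq hc hn hK φ).symm,
    (continuous_supportSlope hc hn hK).intervalIntegrable _ _, ?_, hreal, ?_⟩
  · rw [hper]; exact ENNReal.ofReal_ne_top
  · simp only [cot_psi₁_eq hc hn hK]
    exact hreal
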